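/- Let $\Bbbk$ be a field, $n\ge 0$, $R=\Bbbk[x_1,\dots,x_n]$, let $L\subseteq\mathbb Z^n$ be a lattice (a subgroup), and let $I=I_L=\langle x^u-x^v:\ u,v\in\mathbb N^n,\ u-v\in L\rangle$ be its lattice ideal. A *binomial* is a polynomial $x^u-x^v$ with $u\ne v$ in $\mathbb N^n$. A *Markov basis* of $I$ is a minimal system of binomial generators of $I$ whose cardinality is least among all minimal systems of binomial generators of $I$. Put $L^+=L\cap\mathbb N^n$, let $\sigma=\bigcup_{w\in L^+}\operatorname{supp}(w)$, and let $L_{pure}$ be the subgroup of $L$ generated by $L^+$. For $u\in\mathbb Z^n$ let $u^\sigma=(u_i)_{i\notin\sigma}$. An $I$-*fiber* is a set of monomials $F_u=\{x^v:\ v\in\mathbb N^n,\ v-u\in L\}$ with $u\in\mathbb N^n$; for a binomial $B=x^u-x^v\in I$ put $F_B=F_u=F_v$, and let $F_{\{1\}}$ be the fiber of $1=x^{\mathbf 0}$. For $I$-fibers $F,G$ write $F\equiv_I G$ if $x^uF\subseteq G$ and $x^vG\subseteq F$ for some $u,v\in\mathbb N^n$, let $\overline F$ be the equivalence class of $F$,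 write $\overline F\le_I\overline G$ if $x^uF\subseteq G$ for some $u\in\mathbb N^n$, and $\overline F<_I\overline G$ if moreover $\overline F\neq\overline G$. Let $I_{<\overline F}$ (respectively $I_{\le\overline F}$) be the ideal generated by the binomials $B\in I$ with $\overline F_B<_I\overline F$ (respectively $\overline F_B\le_I\overline F$). For a set $S$ of binomials of $I$ let $S_{\overline F}=\{B\in S:\ F_B\in\overline F\}$. For an $I$-fiber $F$ let $G(M_F)$ be the minimal set of monomial generators of the monomial ideal $M_F=\langle F\rangle$. Let $G_{\overline F}$ be the graph with vertex set $\{a^\sigma:\ x^a\in G(M_F)\}$ in which distinct vertices $p,q$ are adjacent if and only if there are $x^u,x^v\in F$ with $u^\sigma=p$, $v^\sigma=q$ and $x^u-x^v\in I_{<\overline F}$. Let $\Gamma_{\overline F}$ be the complete graph whose vertices are the connected components of $G_{\overline F}$, and let $t(\overline F)$ be the number of its vertices. Let $\Gamma_{\overline F}(S)$ be the subgraph of $\Gamma_{\overline F}$ with all the vertices of $\Gamma_{\overline F}$ whose edges are those given by the binomials of $S$, where a binomial $B=x^u-x^v$ with $F_B\in\overline F$, $u^\sigma\ne v^\sigma$,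 $B\in I_{\le\overline F}$ and $B\notin I_{<\overline F}$ gives the edge joining the components of $u^\sigma$ and $v^\sigma$. (These graphs depend only on $\overline F$.) **Theorem.** Let $S$ be a set of binomials of $I$. Then $S$ is a Markov basis of $I$ if and only if the following three conditions hold: 1. for every $I$-fiber $F$, $\Gamma_{\overline F}(S)$ is a spanning tree of $\Gamma_{\overline F}$, and, if $\overline F\ne\overline F_{\{1\}}$, then $|S_{\overline F}|=t(\overline F)-1$; 2. $|S_{\overline F_{\{1\}}}|=\operatorname{rank}(L_{pure})$; 3. $I_{L_{pure}}=\langle S_{\overline F_{\{1\}}}\rangle$. -/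

import Mathlib

namespace LatticeIdeal

open MvPolynomial

/-! Monomials `x^u` of `k[x_1, …, x_n]` are represented by their exponent vectors `u : Fin n →₀ ℕ`;
a set of monomials is a set of exponent vectors. A lattice is a subgroup of `ℤⁿ`. -/

/-- The exponent vector `u ∈ ℕⁿ` viewed in `ℤⁿ`. -/
def toInt {n : ℕ} (u : Fin n →₀ ℕ) : Fin n → ℤ := fun i => (u i : ℤ)

/-- The difference of monomials `x^u - x^v`. -/
noncomputable def diff (k : Type*) [Field k] {n : ℕ} (u v : Fin n →₀ ℕ) :
    MvPolynomial (Fin n) k :=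
  monomial u 1 - monomial v 1

/-- A binomial is a (nonzero) difference of two distinct monomials. -/
def IsBinomial {k : Type*} [Field k] {n : ℕ} (B : MvPolynomial (Fin n) k) : Prop :=
  ∃ u v : Fin n →₀ ℕ, u ≠ v ∧ B = diff k u v

/-- The lattice ideal `I_L = ⟨x^u - x^v : u - v ∈ L⟩`. -/
noncomputable def latticeIdeal (k : Type*) [Field k] {n : ℕ} (L : AddSubgroup (Fin n → ℤ)) :
    Ideal (MvPolynomial (Fin n) k) :=
  Ideal.span {B | ∃ u v : Fin n →₀ ℕ, toInt u - toInt v ∈ L ∧ B = diff k u v}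

/-- `L⁺ = L ∩ ℕⁿ`. -/
def posPart {n : ℕ} (L : AddSubgroup (Fin n → ℤ)) : Set (Fin n → ℤ) :=
  {w | w ∈ L ∧ ∀ i, 0 ≤ w i}

/-- `σ_L`, the support of `L⁺`. -/
def sigma {n : ℕ} (L : AddSubgroup (Fin n → ℤ)) : Set (Fin n) :=
  {i | ∃ w ∈ posPart L, w i ≠ 0}

/-- `L_pure`, the subgroup generated by `L⁺`. -/
def pureLattice {n : ℕ} (L : AddSubgroup (Fin n → ℤ)) : AddSubgroup (Fin n → ℤ) :=
  AddSubgroup.closure (posPart L)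

/-- `u^σ`, the vector of the coordinates of `u` outside `σ_L`. -/
def outside {n : ℕ} (L : AddSubgroup (Fin n → ℤ)) (u : Fin n →₀ ℕ) :
    {i : Fin n // i ∉ sigma L} → ℕ :=
  fun i => u i

/-- The fiber `F_u` of `x^u`. -/
def fiber {n : ℕ} (L : AddSubgroup (Fin n → ℤ)) (u : Fin n →₀ ℕ) : Set (Fin n →₀ ℕ) :=
  {v | toInt v - toInt u ∈ L}

/-- `F` is an `I_L`-fiber. -/
def IsFiber {n : ℕ} (L : AddSubgroup (Fin n → ℤ)) (F : Set (Fin n →₀ ℕ)) : Prop :=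
  ∃ u, F = fiber L u

/-- `F ≤ G`: some `x^u` satisfies `x^u F ⊆ G`. -/
def FiberLE {n : ℕ} (F G : Set (Fin n →₀ ℕ)) : Prop :=
  ∃ u : Fin n →₀ ℕ, ∀ a ∈ F, u + a ∈ G

/-- `F ≡ G`: there are `u`, `v` with `x^u F ⊆ G` and `x^v G ⊆ F`. -/
def FiberEquiv {n : ℕ} (F G : Set (Fin n →₀ ℕ)) : Prop :=
  ∃ u v : Fin n →₀ ℕ, (∀ a ∈ F, u + a ∈ G) ∧ ∀ b ∈ G, v + b ∈ F

/-- `F < G`: the classes satisfy `F̄ ≤ Ḡ` and `F̄ ≠ Ḡ`. -/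
def FiberLT {n : ℕ} (F G : Set (Fin n →₀ ℕ)) : Prop :=
  FiberLE F G ∧ ¬ FiberEquiv F G

/-- `F̄`, the set of all fibers equivalent to `F`. -/
def fiberClass {n : ℕ} (L : AddSubgroup (Fin n → ℤ)) (F : Set (Fin n →₀ ℕ)) :
    Set (Set (Fin n →₀ ℕ)) :=
  {G | IsFiber L G ∧ FiberEquiv G F}

/-- `I_{<F̄}`, generated by the binomials `B ∈ I_L` with `F̄_B < F̄`. -/
noncomputable def idealLT (k : Type*) [Field k] {n : ℕ} (L : AddSubgroup (Fin n → ℤ))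
    (F : Set (Fin n →₀ ℕ)) : Ideal (MvPolynomial (Fin n) k) :=
  Ideal.span {B | B ∈ latticeIdeal k L ∧
    ∃ u v : Fin n →₀ ℕ, u ≠ v ∧ B = diff k u v ∧ FiberLT (fiber L u) F}

/-- `I_{≤F̄}`, generated by the binomials `B ∈ I_L` with `F̄_B ≤ F̄`. -/
noncomputable def idealLE (k : Type*) [Field k] {n : ℕ} (L : AddSubgroup (Fin n → ℤ))
    (F : Set (Fin n →₀ ℕ)) : Ideal (MvPolynomial (Fin n) k) :=
  Ideal.span {B | B ∈ latticeIdeal k L ∧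
    ∃ u v : Fin n →₀ ℕ, u ≠ v ∧ B = diff k u v ∧ FiberLE (fiber L u) F}

/-- `S_{F̄}`, the set of binomials `B ∈ S` whose fiber `F_B` belongs to `F̄`. -/
def restrict {k : Type*} [Field k] {n : ℕ} (L : AddSubgroup (Fin n → ℤ))
    (S : Set (MvPolynomial (Fin n) k)) (F : Set (Fin n →₀ ℕ)) :
    Set (MvPolynomial (Fin n) k) :=
  {B | B ∈ S ∧ ∃ u v : Fin n →₀ ℕ, u ≠ v ∧ B = diff k u v ∧ fiber L u ∈ fiberClass L F}

/-- `M_F`, the monomial ideal generated by the monomials of `F`. -/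
noncomputable def monomialIdeal (k : Type*) [Field k] {n : ℕ} (F : Set (Fin n →₀ ℕ)) :
    Ideal (MvPolynomial (Fin n) k) :=
  Ideal.span ((fun u : Fin n →₀ ℕ => monomial u (1 : k)) '' F)

/-- `G(J)`, the minimal monomial generators of a monomial ideal `J`: the monomials of `J` that are
minimal for divisibility. -/
def minimalGenerators {k : Type*} [Field k] {n : ℕ} (J : Ideal (MvPolynomial (Fin n) k)) :
    Set (Fin n →₀ ℕ) :=
  {a | Minimal (fun b : Fin n →₀ ℕ => monomial b (1 : k) ∈ J) a}

/-- `G(M_F)^σ`, the vertex set of the graph `G_{F̄}`. -/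
def vertexSet (k : Type*) [Field k] {n : ℕ} (L : AddSubgroup (Fin n → ℤ))
    (F : Set (Fin n →₀ ℕ)) : Set ({i : Fin n // i ∉ sigma L} → ℕ) :=
  outside L '' minimalGenerators (monomialIdeal k F)

/-- The graph `G_{F̄}`: distinct vertices `p`, `q` are joined when there are `x^u, x^v ∈ F` with
`u^σ = p`, `v^σ = q` and `x^u - x^v ∈ I_{<F̄}`. -/
def graphG (k : Type*) [Field k] {n : ℕ} (L : AddSubgroup (Fin n → ℤ))
    (F : Set (Fin n →₀ ℕ)) : SimpleGraph (vertexSet k L F) :=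
  SimpleGraph.fromRel fun p q => ∃ u ∈ F, ∃ v ∈ F,
    outside L u = p ∧ outside L v = q ∧ diff k u v ∈ idealLT k L F

/-- The vertices of `Γ_{F̄}`: the connected components of `G_{F̄}`. -/
abbrev GammaVertex (k : Type*) [Field k] {n : ℕ} (L : AddSubgroup (Fin n → ℤ))
    (F : Set (Fin n →₀ ℕ)) : Type :=
  (graphG k L F).ConnectedComponent

/-- `Γ_{F̄}`, the complete graph on the connected components of `G_{F̄}`. -/
def graphGamma (k : Type*) [Field k] {n : ℕ} (L : AddSubgroup (Fin n → ℤ))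
    (F : Set (Fin n →₀ ℕ)) : SimpleGraph (GammaVertex k L F) :=
  ⊤

/-- `Γ_{F̄}(S)`, the graph on the vertices of `Γ_{F̄}` whose edges are those given by the binomials
of `S`. A binomial `B = x^u - x^v` with `F_B ∈ F̄`, `u^σ ≠ v^σ`, `B ∈ I_{≤F̄}` and `B ∉ I_{<F̄}`
gives the edge that joins the components containing `u^σ` and `v^σ`. -/
def graphGammaOf {k : Type*} [Field k] {n : ℕ} (L : AddSubgroup (Fin n → ℤ))
    (S : Set (MvPolynomial (Fin n) k)) (F : Set (Fin n →₀ ℕ)) :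
    SimpleGraph (GammaVertex k L F) :=
  SimpleGraph.fromRel fun c d => ∃ (u v : Fin n →₀ ℕ) (p q : vertexSet k L F),
    diff k u v ∈ S ∧ fiber L u ∈ fiberClass L F ∧
    outside L u ≠ outside L v ∧ diff k u v ∈ idealLE k L F ∧ diff k u v ∉ idealLT k L F ∧
    outside L u = p ∧ outside L v = q ∧
    (graphG k L F).connectedComponentMk p = c ∧ (graphG k L F).connectedComponentMk q = d

/-- `t(F̄)`, the number of vertices of `Γ_{F̄}`. -/
noncomputable def t (k : Type*) [Field k] {n : ℕ} (L : AddSubgroup (Fin n → ℤ))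
    (F : Set (Fin n →₀ ℕ)) : ℕ∞ :=
  ENat.card (GammaVertex k L F)

/-- `H` is a spanning tree of the graph `G` (both graphs have the same vertex set). -/
def IsSpanningTree {V : Type*} (H G : SimpleGraph V) : Prop :=
  H ≤ G ∧ H.IsTree

/-- `S` is a minimal system of binomial generators of `I_L`. -/
def IsMinimalBinomialGeneratingSet {k : Type*} [Field k] {n : ℕ} (L : AddSubgroup (Fin n → ℤ))
    (S : Set (MvPolynomial (Fin n) k)) : Prop :=
  (∀ B ∈ S, IsBinomial B) ∧ Ideal.span S = latticeIdeal k L ∧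
    ∀ T, T ⊂ S → Ideal.span T ≠ latticeIdeal k L

/-- `S` is a Markov basis of `I_L`: a minimal system of binomial generators of least cardinality. -/
def IsMarkovBasis {k : Type*} [Field k] {n : ℕ} (L : AddSubgroup (Fin n → ℤ))
    (S : Set (MvPolynomial (Fin n) k)) : Prop :=
  IsMinimalBinomialGeneratingSet L S ∧
    ∀ T : Set (MvPolynomial (Fin n) k), IsMinimalBinomialGeneratingSet L T → S.encard ≤ T.encard

end LatticeIdeal

namespace LatticeIdeal

open MvPolynomial

variable {k : Type*} [Field k] {n : ℕ} {L : AddSubgroup (Fin n → ℤ)}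

/-! Vectors supported in σ are invertible modulo L (`exists_add_mem`), so only coordinates outside σ
matter for the order on classes of fibers. Within a fiber these outside parts form a finite
antichain, so Γ is finite.

In a class other than that of 1, two fiber elements lie in the same vertex of Γ exactly when their
difference is in I_{<F̄} (`comp_eq_iff`). Generating sets therefore make Γ(S) connected and need at
least t - 1 binomials there (`connected_graphGammaOf`, `t_le_encard_restrict`). Conversely,
connected graphs together with generators of the pure part generate I, by descent on the degree
outside σ (`span_eq_of_connected`). In the class of 1, the binomials of a generating set generate
I_{L_pure} (`latticeIdeal_pureLattice_eq`). This takes at least rank L_pure binomials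
(`finrank_le_encard`), and that many suffice (`exists_generators_pureLattice`).

The lower bounds hold class by class, so a generating S attaining all of them is minimal and of
least cardinality. A Markov basis attains them because the binomials of one class can be exchanged
(`span_exchange`) for those of a spanning tree, or for rank L_pure generators in the class of 1.

Generation is tested through additive congruences on ℕⁿ (`con_of_diff_mem_span`). -/

/-! ### Exponent vectors modulo L, inside and outside σ. -/

@[simp] lemma toInt_add (u v : Fin n →₀ ℕ) : toInt (u + v) = toInt u + toInt v := by
  ext i; simp [toInt]

@[simp] lemma toInt_zero : toInt (0 : Fin n →₀ ℕ) = 0 := by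
  ext i; simp [toInt]

lemma toInt_tsub {u v : Fin n →₀ ℕ} (h : u ≤ v) : toInt (v - u) = toInt v - toInt u := by
  rw [eq_sub_iff_add_eq, ← toInt_add, tsub_add_cancel_of_le h]

@[simp] lemma outside_add (u v : Fin n →₀ ℕ) :
    outside L (u + v) = outside L u + outside L v := by
  ext i; simp [outside]

@[simp] lemma outside_zero : outside L (0 : Fin n →₀ ℕ) = 0 := by
  ext i; simp [outside]

lemma outside_eq_zero_iff {u : Fin n →₀ ℕ} :
    outside L u = 0 ↔ ∀ i, i ∉ sigma L → u i = 0 := by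
  simp [funext_iff, outside]

lemma outside_tsub (u v : Fin n →₀ ℕ) :
    outside L (u - v) = outside L u - outside L v := by
  ext i; simp [outside]

/-- A nonnegative vector with integral image in the lattice is supported in `σ`. -/
lemma outside_eq_zero_of_mem {w : Fin n →₀ ℕ} (hw : toInt w ∈ L) : outside L w = 0 := by
  rw [outside_eq_zero_iff]
  intro i hi
  by_contra h
  exact hi ⟨toInt w, ⟨hw, fun j => by simp [toInt]⟩, by simpa [toInt] using h⟩

lemma exists_toInt_eq {w : Fin n → ℤ} (hw : ∀ i, 0 ≤ w i) :
    ∃ u : Fin n →₀ ℕ, toInt u = w :=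
  ⟨Finsupp.equivFunOnFinite.symm fun i => (w i).toNat, by
    ext i; simpa [toInt] using hw i⟩

/-- The elements of `L⁺` dominate every vector on `σ`. -/
lemma exists_mem_ge (L : AddSubgroup (Fin n → ℤ)) (a : Fin n →₀ ℕ) :
    ∃ w : Fin n →₀ ℕ, toInt w ∈ L ∧ ∀ i ∈ sigma L, a i ≤ w i := by
  have h : ∀ i, ∃ w : Fin n →₀ ℕ, toInt w ∈ L ∧ (i ∈ sigma L → w i ≠ 0) := by
    intro i
    by_cases hi : i ∈ sigma L
    · obtain ⟨w, ⟨hw, h0⟩, hi⟩ := hi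
      obtain ⟨u, rfl⟩ := exists_toInt_eq h0
      exact ⟨u, hw, fun _ h => hi (by simp [toInt, h])⟩
    · exact ⟨0, by simp [L.zero_mem], fun h => absurd h hi⟩
  choose w hw hi using h
  refine ⟨∑ i, a i • w i, ?_, fun i his => ?_⟩
  · have : toInt (∑ i, a i • w i) = ∑ i, a i • toInt (w i) := by
      ext j; simp [toInt, Finsupp.finsetSum_apply]
    rw [this]
    exact sum_mem fun i _ => L.nsmul_mem (hw i) _
  · rw [Finsupp.finsetSum_apply]
    refine le_trans ?_ (Finset.single_le_sum (f := fun j => (a j • w j) i)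
      (fun _ _ => Nat.zero_le _) (Finset.mem_univ i))
    simpa using Nat.le_mul_of_pos_right (a i) (Nat.pos_of_ne_zero (hi i his))

/-- Vectors supported in `σ` are invertible modulo `L`. -/
lemma exists_add_mem {u : Fin n →₀ ℕ} (hu : outside L u = 0) :
    ∃ v : Fin n →₀ ℕ, outside L v = 0 ∧ toInt (u + v) ∈ L := by
  obtain ⟨w, hw, hle⟩ := exists_mem_ge L u
  have huw : u ≤ w := fun i => by
    by_cases hi : i ∈ sigma L
    · exact hle i hi
    · simp [outside_eq_zero_iff.1 hu i hi]
  exact ⟨w - u, by simp [outside_tsub, hu, outside_eq_zero_of_mem hw],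
    by rwa [add_tsub_cancel_of_le huw]⟩

/-- Congruent vectors that are comparable outside `σ` agree outside `σ`. -/
lemma outside_eq_of_le {a b : Fin n →₀ ℕ} (h : toInt a - toInt b ∈ L)
    (hle : outside L a ≤ outside L b) : outside L a = outside L b := by
  -- Adding `w` makes up for the coordinates in σ, so `b + w - a` is a nonnegative vector of L and
  -- must vanish outside σ, as `w` does.
  obtain ⟨w, hw, hge⟩ := exists_mem_ge L a
  have haw : a ≤ b + w := fun i => by
    by_cases hi : i ∈ sigma L
    · exact (hge i hi).trans (by simp)
    · have := hle ⟨i, hi⟩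
      simp only [outside] at this
      simpa using this.trans (Nat.le_add_right _ _)
  have hm : toInt (b + w - a) ∈ L := by
    rw [toInt_tsub haw, toInt_add]
    have := L.sub_mem hw h
    convert this using 1
    abel
  have h0 := outside_eq_zero_of_mem hm
  rw [outside_tsub, outside_add, outside_eq_zero_of_mem hw, add_zero] at h0
  exact le_antisymm hle (tsub_eq_zero_iff_le.1 h0)

lemma outside_eq_zero_of_congr {a b : Fin n →₀ ℕ} (h : toInt a - toInt b ∈ L)
    (ha : outside L a = 0) : outside L b = 0 := by
  rw [← outside_eq_of_le h (by rw [ha]; exact zero_le), ha]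

/-! ### Fibers -/

lemma mem_fiber {u v : Fin n →₀ ℕ} : v ∈ fiber L u ↔ toInt v - toInt u ∈ L := Iff.rfl

lemma self_mem_fiber (u : Fin n →₀ ℕ) : u ∈ fiber L u := by simp [mem_fiber, L.zero_mem]

lemma congr_symm {u v : Fin n →₀ ℕ} (h : toInt u - toInt v ∈ L) : toInt v - toInt u ∈ L := by
  simpa using L.neg_mem h

lemma congr_trans {u v w : Fin n →₀ ℕ} (h : toInt u - toInt v ∈ L) (h' : toInt v - toInt w ∈ L) :
    toInt u - toInt w ∈ L := by
  simpa using L.add_mem h h'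

lemma congr_add_left {u v : Fin n →₀ ℕ} (c : Fin n →₀ ℕ) :
    toInt (c + u) - toInt (c + v) ∈ L ↔ toInt u - toInt v ∈ L := by
  simp

lemma congr_add_right {u v : Fin n →₀ ℕ} (c : Fin n →₀ ℕ) :
    toInt (u + c) - toInt (v + c) ∈ L ↔ toInt u - toInt v ∈ L := by
  simp

lemma fiber_eq_of_congr {u v : Fin n →₀ ℕ} (h : toInt u - toInt v ∈ L) :
    fiber L u = fiber L v :=
  Set.ext fun _ => ⟨fun h' => congr_trans h' h, fun h' => congr_trans h' (congr_symm h)⟩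

lemma fiberLE_iff {a b : Fin n →₀ ℕ} :
    FiberLE (fiber L a) (fiber L b) ↔ ∃ c, toInt (c + a) - toInt b ∈ L :=
  ⟨fun ⟨c, h⟩ => ⟨c, h a (self_mem_fiber a)⟩, fun ⟨c, h⟩ =>
    ⟨c, fun _ hx => congr_trans ((congr_add_left c).2 hx) h⟩⟩

/-- The round trip between the fibers shifts by a nonnegative vector of L, so both shifts are
supported in σ. Conversely, a shift supported in σ can be undone modulo L. -/
lemma fiberEquiv_iff {a b : Fin n →₀ ℕ} :
    FiberEquiv (fiber L a) (fiber L b) ↔ ∃ c, outside L c = 0 ∧ toInt (c + a) - toInt b ∈ L := by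
  constructor
  · rintro ⟨u, v, h, h'⟩
    have h1 : toInt (v + (u + a)) - toInt a ∈ L := h' _ (h a (self_mem_fiber a))
    have h2 : toInt (v + u) ∈ L := by
      rwa [← add_assoc, toInt_add, add_sub_cancel_right] at h1
    have h3 := outside_eq_zero_of_mem h2
    rw [outside_add] at h3
    exact ⟨u, (add_eq_zero.1 h3).2, h a (self_mem_fiber a)⟩
  · rintro ⟨c, hc, h⟩
    obtain ⟨v, hv, hm⟩ := exists_add_mem hc
    refine ⟨c, v, fun x hx => congr_trans ((congr_add_left c).2 hx) h, fun x hx => ?_⟩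
    refine congr_trans ((congr_add_left v).2 (congr_trans hx (congr_symm h))) ?_
    rw [← add_assoc, toInt_add, add_sub_cancel_right, add_comm]
    exact hm

lemma FiberEquiv.symm {F G : Set (Fin n →₀ ℕ)} (h : FiberEquiv F G) : FiberEquiv G F := by
  obtain ⟨u, v, h, h'⟩ := h
  exact ⟨v, u, h', h⟩

lemma FiberEquiv.trans {F G H : Set (Fin n →₀ ℕ)} (h : FiberEquiv F G) (h' : FiberEquiv G H) :
    FiberEquiv F H := by
  obtain ⟨u, v, h1, h2⟩ := h
  obtain ⟨u', v', h3, h4⟩ := h'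
  refine ⟨u' + u, v + v', fun a ha => ?_, fun a ha => ?_⟩
  · rw [add_assoc]; exact h3 _ (h1 _ ha)
  · rw [add_assoc]; exact h2 _ (h4 _ ha)

lemma FiberEquiv.le {F G : Set (Fin n →₀ ℕ)} (h : FiberEquiv F G) : FiberLE F G :=
  let ⟨u, _, h, _⟩ := h; ⟨u, h⟩

lemma fiber_mem_fiberClass_iff {a b : Fin n →₀ ℕ} :
    fiber L a ∈ fiberClass L (fiber L b) ↔ FiberEquiv (fiber L a) (fiber L b) :=
  ⟨fun h => h.2, fun h => ⟨⟨a, rfl⟩, h⟩⟩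

lemma fiberEquiv_refl (a : Fin n →₀ ℕ) : FiberEquiv (fiber L a) (fiber L a) :=
  fiberEquiv_iff.2 ⟨0, outside_zero, by simp [L.zero_mem]⟩

lemma fiberClass_eq {a b : Fin n →₀ ℕ} (h : FiberEquiv (fiber L a) (fiber L b)) :
    fiberClass L (fiber L a) = fiberClass L (fiber L b) :=
  Set.ext fun _ => ⟨fun h' => ⟨h'.1, h'.2.trans h⟩, fun h' => ⟨h'.1, h'.2.trans h.symm⟩⟩

lemma fiberEquiv_zero_iff {a : Fin n →₀ ℕ} :
    FiberEquiv (fiber L a) (fiber L 0) ↔ outside L a = 0 := by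
  rw [fiberEquiv_iff]
  constructor
  · rintro ⟨c, -, h⟩
    rw [toInt_zero, sub_zero] at h
    have := outside_eq_zero_of_mem h
    rw [outside_add] at this
    exact (add_eq_zero.1 this).2
  · intro h
    obtain ⟨v, hv, hm⟩ := exists_add_mem h
    exact ⟨v, hv, by rwa [toInt_zero, sub_zero, add_comm]⟩

/-- The multiples of a fiber that stay in its class. -/
lemma fiberEquiv_iff_of_congr {a b c : Fin n →₀ ℕ} (h : toInt (c + a) - toInt b ∈ L) :
    FiberEquiv (fiber L a) (fiber L b) ↔ outside L c = 0 := by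
  rw [fiberEquiv_iff]
  refine ⟨?_, fun hc => ⟨c, hc, h⟩⟩
  rintro ⟨d, hd, h'⟩
  have h1 : toInt d - toInt c ∈ L := (congr_add_right a).1 (congr_trans h' (congr_symm h))
  exact outside_eq_zero_of_congr h1 hd

/-! ### Differences of monomials -/

lemma diff_self (u : Fin n →₀ ℕ) : diff k u u = 0 := by simp [diff]

lemma neg_diff (u v : Fin n →₀ ℕ) : -diff k u v = diff k v u := by simp [diff]

lemma diff_add_diff (u v w : Fin n →₀ ℕ) : diff k u v + diff k v w = diff k u w := by
  simp [diff]

lemma monomial_mul_diff (c u v : Fin n →₀ ℕ) :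
    monomial c 1 * diff k u v = diff k (c + u) (c + v) := by
  simp [diff, mul_sub, monomial_mul]

section Ideal

variable {J : Ideal (MvPolynomial (Fin n) k)} {u v w : Fin n →₀ ℕ}

lemma diff_mem_symm (h : diff k u v ∈ J) : diff k v u ∈ J := by
  rw [← neg_diff]; exact J.neg_mem h

lemma diff_mem_trans (h : diff k u v ∈ J) (h' : diff k v w ∈ J) : diff k u w ∈ J := by
  rw [← diff_add_diff u v w]; exact J.add_mem h h'

lemma diff_mem_add_left (c : Fin n →₀ ℕ) (h : diff k u v ∈ J) : diff k (c + u) (c + v) ∈ J := by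
  rw [← monomial_mul_diff]; exact J.mul_mem_left _ h

lemma diff_mem_add_right (c : Fin n →₀ ℕ) (h : diff k u v ∈ J) : diff k (u + c) (v + c) ∈ J := by
  rw [add_comm u, add_comm v]; exact diff_mem_add_left c h

end Ideal

/-- A nonzero difference of monomials determines its two monomials up to order. -/
lemma diff_eq_diff {u v u' v' : Fin n →₀ ℕ} (huv : u ≠ v) (h : diff k u v = diff k u' v') :
    s(u, v) = s(u', v') := by
  classical
  have hc : ∀ w, (if u = w then (1 : k) else 0) - (if v = w then 1 else 0) =
      (if u' = w then 1 else 0) - (if v' = w then 1 else 0) := fun w => by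
    simpa [diff, coeff_monomial] using congrArg (coeff w) h
  have h1 := hc u
  have h2 := hc v
  rw [if_pos rfl, if_neg huv.symm] at h1
  rw [if_neg huv, if_pos rfl] at h2
  have hu : u' = u ∨ v' = u := by
    by_contra! hne
    simp [hne.1, hne.2] at h1
  have hv : u' = v ∨ v' = v := by
    by_contra! hne
    simp [hne.1, hne.2] at h2
  rw [Sym2.eq_iff]
  rcases hu with hu | hu <;> rcases hv with hv | hv
  · exact absurd (hu.symm.trans hv) huv
  · exact .inl ⟨hu.symm, hv.symm⟩
  · exact .inr ⟨hu.symm, hv.symm⟩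
  · exact absurd (hu.symm.trans hv) huv

/-- A difference of monomials in an ideal generated by differences of congruent monomials has
congruent monomials. -/
lemma con_of_diff_mem_span (d : AddCon (Fin n →₀ ℕ)) {X : Set (MvPolynomial (Fin n) k)}
    (hX : ∀ B ∈ X, ∃ u v, B = diff k u v ∧ d u v) {u v : Fin n →₀ ℕ}
    (h : diff k u v ∈ Ideal.span X) : d u v := by
  -- The algebra of the quotient monoid kills the generators but keeps monomials of distinct classes
  -- distinct.
  let f : MvPolynomial (Fin n) k →+* AddMonoidAlgebra k d.Quotient :=
    AddMonoidAlgebra.mapDomainRingHom k d.mk'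
  have hf : ∀ u v, f (diff k u v) =
      AddMonoidAlgebra.single (d.mk' u) 1 - AddMonoidAlgebra.single (d.mk' v) 1 := by
    intro u v
    rw [diff, map_sub]
    congr 1 <;> exact AddMonoidAlgebra.mapDomain_single
  have hle : Ideal.span X ≤ RingHom.ker f := by
    rw [Ideal.span_le]
    intro B hB
    obtain ⟨u, v, rfl, huv⟩ := hX B hB
    have : d.mk' u = d.mk' v := d.eq.2 huv
    simp [RingHom.mem_ker, hf, this]
  have h0 := hle h
  rw [RingHom.mem_ker, hf, sub_eq_zero] at h0
  exact d.eq.1 (AddMonoidAlgebra.of_injective (R := k) (M := d.Quotient) h0)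

/-- Congruence of exponent vectors modulo a lattice. -/
def latticeCon (L : AddSubgroup (Fin n → ℤ)) : AddCon (Fin n →₀ ℕ) where
  r u v := toInt u - toInt v ∈ L
  iseqv := ⟨fun u => by simp [L.zero_mem], congr_symm, congr_trans⟩
  add' {a b c d} h h' := congr_trans ((congr_add_right c).2 h) ((congr_add_left b).2 h')

lemma diff_mem_latticeIdeal_iff {u v : Fin n →₀ ℕ} :
    diff k u v ∈ latticeIdeal k L ↔ toInt u - toInt v ∈ L := by
  refine ⟨fun h => ?_, fun h => Ideal.subset_span ⟨u, v, h, rfl⟩⟩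
  refine con_of_diff_mem_span (latticeCon L) ?_ h
  rintro B ⟨u, v, h, rfl⟩
  exact ⟨u, v, rfl, h⟩

/-! ### The graphs `G` and `Γ` -/

lemma monomial_mem_monomialIdeal_iff {F : Set (Fin n →₀ ℕ)} {b : Fin n →₀ ℕ} :
    monomial b (1 : k) ∈ monomialIdeal k F ↔ ∃ a ∈ F, a ≤ b := by
  classical
  rw [monomialIdeal, mem_ideal_span_monomial_image]
  simp [support_monomial]

/-- A minimal monomial below an element of the fiber has the same part outside σ, because comparable
outside parts agree. Hence minimality can be forgotten. -/
lemma vertexSet_eq (k : Type*) [Field k] (L : AddSubgroup (Fin n → ℤ)) (a : Fin n →₀ ℕ) :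
    vertexSet k L (fiber L a) = outside L '' fiber L a := by
  apply Set.Subset.antisymm
  · rintro _ ⟨b, hb, rfl⟩
    obtain ⟨c, hc, hcb⟩ := monomial_mem_monomialIdeal_iff.1 hb.1
    have := hb.2 (monomial_mem_monomialIdeal_iff.2 ⟨c, hc, le_rfl⟩) hcb
    exact ⟨b, by rwa [le_antisymm this hcb], rfl⟩
  · rintro _ ⟨b, hb, rfl⟩
    obtain ⟨c, hcb, hc⟩ := exists_minimal_le_of_wellFoundedLT (· ∈ fiber L a) b hb
    refine ⟨c, ⟨monomial_mem_monomialIdeal_iff.2 ⟨c, hc.1, le_rfl⟩, fun d hd hdc => ?_⟩, ?_⟩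
    · obtain ⟨x, hx, hxd⟩ := monomial_mem_monomialIdeal_iff.1 hd
      exact (hc.2 hx (hxd.trans hdc)).trans hxd
    · exact outside_eq_of_le (congr_trans hc.1 (congr_symm hb)) fun i => hcb i

/-- Outside parts within a fiber are pairwise incomparable, and Dickson's lemma makes antichains
finite. -/
lemma finite_outside_image (a : Fin n →₀ ℕ) : (outside L '' fiber L a).Finite := by
  apply WellQuasiOrderedLE.finite_of_isAntichain
  rintro _ ⟨b, hb, rfl⟩ _ ⟨c, hc, rfl⟩ hne hle
  exact hne (outside_eq_of_le (congr_trans hb (congr_symm hc)) hle)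

instance finite_vertexSet (a : Fin n →₀ ℕ) : Finite (vertexSet k L (fiber L a)) := by
  rw [vertexSet_eq]
  exact finite_outside_image a

instance finite_gammaVertex (a : Fin n →₀ ℕ) : Finite (GammaVertex k L (fiber L a)) :=
  Quot.finite _

lemma outside_mem_vertexSet {a u : Fin n →₀ ℕ} (hu : u ∈ fiber L a) :
    outside L u ∈ vertexSet k L (fiber L a) := by
  rw [vertexSet_eq]
  exact ⟨u, hu, rfl⟩

/-- The vertex of `Γ` that contains a given element of the fiber. -/
noncomputable def comp (k : Type*) [Field k] {a u : Fin n →₀ ℕ} (hu : u ∈ fiber L a) :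
    GammaVertex k L (fiber L a) :=
  (graphG k L (fiber L a)).connectedComponentMk ⟨outside L u, outside_mem_vertexSet hu⟩

lemma comp_congr {a u v : Fin n →₀ ℕ} (hu : u ∈ fiber L a) (hv : v ∈ fiber L a)
    (h : outside L u = outside L v) : comp k hu = comp k hv := by
  simp only [comp, h]

lemma exists_comp_eq {a : Fin n →₀ ℕ} (c : GammaVertex k L (fiber L a)) :
    ∃ u, ∃ hu : u ∈ fiber L a, comp k hu = c := by
  obtain ⟨⟨p, hp⟩, rfl⟩ := Quot.exists_rep c
  have hp' := hp
  rw [vertexSet_eq] at hp'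
  obtain ⟨u, hu, rfl⟩ := hp'
  exact ⟨u, hu, rfl⟩

lemma fiberLE_of_outside_eq_zero {s a : Fin n →₀ ℕ} (hs : outside L s = 0) :
    FiberLE (fiber L s) (fiber L a) := by
  obtain ⟨v, -, hm⟩ := exists_add_mem hs
  refine fiberLE_iff.2 ⟨a + v, ?_⟩
  rw [add_assoc, add_comm v, toInt_add, add_sub_cancel_left]
  exact hm

lemma diff_mem_idealLT {a u v : Fin n →₀ ℕ} (huv : toInt u - toInt v ∈ L)
    (hlt : FiberLT (fiber L u) (fiber L a)) : diff k u v ∈ idealLT k L (fiber L a) := by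
  by_cases h : u = v
  · rw [h, diff_self]
    exact zero_mem _
  · exact Ideal.subset_span ⟨diff_mem_latticeIdeal_iff.2 huv, u, v, h, rfl, hlt⟩

/-- Dividing by the gcd `u ⊓ v` leaves a binomial supported in σ, which belongs to the class of 1.
That class is strictly below F̄ because `ha` excludes equality. -/
lemma diff_mem_idealLT_of_outside_eq {a u v : Fin n →₀ ℕ} (ha : outside L a ≠ 0)
    (huv : toInt u - toInt v ∈ L) (h : outside L u = outside L v) :
    diff k u v ∈ idealLT k L (fiber L a) := by
  have hi : ∀ i, i ∉ sigma L → u i = v i := fun i hi => congrFun h ⟨i, hi⟩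
  have hc : ∀ x y : Fin n →₀ ℕ, (∀ i, i ∉ sigma L → x i = y i) →
      outside L (x - x ⊓ y) = 0 := by
    intro x y hxy
    rw [outside_eq_zero_iff]
    intro i hi
    simp [hxy i hi]
  have hu : u ⊓ v + (u - u ⊓ v) = u := add_tsub_cancel_of_le inf_le_left
  have hv : u ⊓ v + (v - u ⊓ v) = v := add_tsub_cancel_of_le inf_le_right
  have hs := hc u v hi
  have hlt : FiberLT (fiber L (u - u ⊓ v)) (fiber L a) :=
    ⟨fiberLE_of_outside_eq_zero hs, fun he =>
      ha (fiberEquiv_zero_iff.1 (he.symm.trans (fiberEquiv_zero_iff.2 hs)))⟩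
  have hm : toInt (u - u ⊓ v) - toInt (v - u ⊓ v) ∈ L := by
    rwa [toInt_tsub inf_le_left, toInt_tsub inf_le_right, sub_sub_sub_cancel_right]
  have := diff_mem_add_left (u ⊓ v) (diff_mem_idealLT (k := k) hm hlt)
  rwa [hu, hv] at this

/-- Elements with the same outside part already agree modulo I_{<F̄}, so the edges of a path in G
can be concatenated. The class of 1 is excluded: there I_{<F̄} is zero, while Γ is a single vertex.
-/
lemma comp_eq_iff {a u v : Fin n →₀ ℕ} (ha : outside L a ≠ 0) (hu : u ∈ fiber L a)
    (hv : v ∈ fiber L a) :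
    comp k hu = comp k hv ↔ diff k u v ∈ idealLT k L (fiber L a) := by
  constructor
  · intro h
    have key : ∀ p q : vertexSet k L (fiber L a), (graphG k L (fiber L a)).Reachable p q →
        ∀ u ∈ fiber L a, ∀ v ∈ fiber L a, outside L u = p → outside L v = q →
          diff k u v ∈ idealLT k L (fiber L a) := by
      rintro p q ⟨w⟩
      induction w with
      | nil =>
        intro u hu v hv h1 h2
        exact diff_mem_idealLT_of_outside_eq ha (congr_trans hu (congr_symm hv)) (h1.trans h2.symm)
      | cons hadj _ ih =>
        intro u hu v hv h1 h2
        rw [graphG, SimpleGraph.fromRel_adj] at hadj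
        obtain ⟨-, ⟨x, hx, y, hy, hxp, hyq, hd⟩ | ⟨y, hy, x, hx, hyq, hxp, hd⟩⟩ := hadj
        · exact diff_mem_trans (diff_mem_idealLT_of_outside_eq ha
            (congr_trans hu (congr_symm hx)) (h1.trans hxp.symm))
            (diff_mem_trans hd (ih y hy v hv hyq h2))
        · exact diff_mem_trans (diff_mem_idealLT_of_outside_eq ha
            (congr_trans hu (congr_symm hx)) (h1.trans hxp.symm))
            (diff_mem_trans (diff_mem_symm hd) (ih y hy v hv hyq h2))
    exact key _ _ (SimpleGraph.ConnectedComponent.eq.1 h) u hu v hv rfl rfl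
  · intro h
    by_cases heq : outside L u = outside L v
    · exact comp_congr hu hv heq
    · refine SimpleGraph.ConnectedComponent.eq.2 (SimpleGraph.Adj.reachable ?_)
      rw [graphG, SimpleGraph.fromRel_adj]
      exact ⟨fun h => heq (congrArg Subtype.val h), .inl ⟨u, hu, v, hv, rfl, rfl, h⟩⟩

/-- The binomial `B` gives the pair `e` of vertices of `Γ`. -/
def Joins (a : Fin n →₀ ℕ) (B : MvPolynomial (Fin n) k)
    (e : Sym2 (GammaVertex k L (fiber L a))) : Prop :=
  ∃ u v x : Fin n →₀ ℕ, B = diff k u v ∧ outside L x = 0 ∧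
    ∃ (hu : x + u ∈ fiber L a) (hv : x + v ∈ fiber L a), e = s(comp k hu, comp k hv)

/-- The side conditions in the definition of Γ(S) follow once the endpoints are distinct: equal
outside parts, or membership in I_{<F̄}, would put them in one vertex. -/
lemma adj_iff {a : Fin n →₀ ℕ} (ha : outside L a ≠ 0) {S : Set (MvPolynomial (Fin n) k)}
    (hS : ∀ B ∈ S, B ∈ latticeIdeal k L) {c d : GammaVertex k L (fiber L a)} :
    (graphGammaOf L S (fiber L a)).Adj c d ↔ c ≠ d ∧ ∃ B ∈ S, Joins a B s(c, d) := by
  rw [graphGammaOf, SimpleGraph.fromRel_adj]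
  refine and_congr_right fun hne => ⟨fun h => ?_, ?_⟩
  · have key : ∀ c d : GammaVertex k L (fiber L a),
        (∃ (u v : Fin n →₀ ℕ) (p q : vertexSet k L (fiber L a)),
          diff k u v ∈ S ∧ fiber L u ∈ fiberClass L (fiber L a) ∧
          outside L u ≠ outside L v ∧ diff k u v ∈ idealLE k L (fiber L a) ∧
          diff k u v ∉ idealLT k L (fiber L a) ∧ outside L u = p ∧ outside L v = q ∧
          (graphG k L (fiber L a)).connectedComponentMk p = c ∧
          (graphG k L (fiber L a)).connectedComponentMk q = d) →
        ∃ B ∈ S, Joins a B s(c, d) := by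
      rintro c d ⟨u, v, ⟨p, hp⟩, ⟨q, hq⟩, hB, hF, -, -, -, h1, h2, rfl, rfl⟩
      obtain ⟨x, hx, hxu⟩ := fiberEquiv_iff.1 (fiber_mem_fiberClass_iff.1 hF)
      have hxv : x + v ∈ fiber L a := congr_trans ((congr_add_left x).2
        (congr_symm (diff_mem_latticeIdeal_iff.1 (hS _ hB)))) hxu
      refine ⟨_, hB, u, v, x, rfl, hx, hxu, hxv, ?_⟩
      simp only at h1 h2
      subst h1 h2
      simp only [comp, outside_add, hx, zero_add]
    rcases h with h | h
    · exact key c d h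
    · rw [Sym2.eq_swap]
      exact key d c h
  · rintro ⟨B, hB, u, v, x, rfl, hx, hu, hv, he⟩
    have key : comp k hu ≠ comp k hv → ∃ (u' v' : Fin n →₀ ℕ) (p q : vertexSet k L (fiber L a)),
          diff k u' v' ∈ S ∧ fiber L u' ∈ fiberClass L (fiber L a) ∧
          outside L u' ≠ outside L v' ∧ diff k u' v' ∈ idealLE k L (fiber L a) ∧
          diff k u' v' ∉ idealLT k L (fiber L a) ∧ outside L u' = p ∧ outside L v' = q ∧
          (graphG k L (fiber L a)).connectedComponentMk p = comp k hu ∧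
          (graphG k L (fiber L a)).connectedComponentMk q = comp k hv := by
      intro hne
      have hE : FiberEquiv (fiber L u) (fiber L a) := fiberEquiv_iff.2 ⟨x, hx, hu⟩
      refine ⟨u, v, ⟨_, outside_mem_vertexSet hu⟩, ⟨_, outside_mem_vertexSet hv⟩, hB,
        fiber_mem_fiberClass_iff.2 hE, ?_, ?_, ?_, by simp [hx], by simp [hx], rfl, rfl⟩
      · exact fun h => hne (comp_congr hu hv (by simp [h]))
      · refine Ideal.subset_span ⟨hS _ hB, u, v, ?_, rfl, hE.le⟩
        rintro rfl
        exact hne rfl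
      · exact fun h => hne ((comp_eq_iff ha hu hv).2 (diff_mem_add_left x h))
    rcases Sym2.eq_iff.1 he with ⟨rfl, rfl⟩ | ⟨rfl, rfl⟩
    · exact .inl (key hne)
    · exact .inr (key hne.symm)

lemma mem_edgeSet_iff {a : Fin n →₀ ℕ} (ha : outside L a ≠ 0) {S : Set (MvPolynomial (Fin n) k)}
    (hS : ∀ B ∈ S, B ∈ latticeIdeal k L) {e : Sym2 (GammaVertex k L (fiber L a))} :
    e ∈ (graphGammaOf L S (fiber L a)).edgeSet ↔ ¬ e.IsDiag ∧ ∃ B ∈ S, Joins a B e := by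
  induction e with
  | h c d => rw [SimpleGraph.mem_edgeSet, adj_iff ha hS, Sym2.mk_isDiag_iff]

/-- A binomial fixes its monomials up to order, and shifts supported in σ do not change the vertex.
This makes the choice of one binomial per edge injective. -/
lemma Joins.eq {a : Fin n →₀ ℕ} {B : MvPolynomial (Fin n) k}
    {e e' : Sym2 (GammaVertex k L (fiber L a))} (h : Joins a B e) (h' : Joins a B e')
    (he : ¬ e.IsDiag) : e = e' := by
  obtain ⟨u, v, x, rfl, hx, hu, hv, rfl⟩ := h
  obtain ⟨u', v', x', hB, hx', hu', hv', rfl⟩ := h'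
  have huv : u ≠ v := by
    rintro rfl
    exact he rfl
  rcases Sym2.eq_iff.1 (diff_eq_diff huv hB) with ⟨rfl, rfl⟩ | ⟨rfl, rfl⟩
  · rw [comp_congr hu hu' (by simp [hx, hx']), comp_congr hv hv' (by simp [hx, hx'])]
  · rw [comp_congr hu hv' (by simp [hx, hx']), comp_congr hv hu' (by simp [hx, hx']),
      Sym2.eq_swap]

lemma Joins.mem_restrict {a : Fin n →₀ ℕ} {S : Set (MvPolynomial (Fin n) k)}
    {B : MvPolynomial (Fin n) k} {e : Sym2 (GammaVertex k L (fiber L a))} (h : Joins a B e)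
    (he : ¬ e.IsDiag) (hB : B ∈ S) : B ∈ restrict L S (fiber L a) := by
  obtain ⟨u, v, x, rfl, hx, hu, hv, rfl⟩ := h
  refine ⟨hB, u, v, ?_, rfl, fiber_mem_fiberClass_iff.2 (fiberEquiv_iff.2 ⟨x, hx, hu⟩)⟩
  rintro rfl
  exact he rfl

lemma encard_edgeSet_le {a : Fin n →₀ ℕ} (ha : outside L a ≠ 0)
    {S : Set (MvPolynomial (Fin n) k)} (hS : ∀ B ∈ S, B ∈ latticeIdeal k L) :
    (graphGammaOf L S (fiber L a)).edgeSet.encard ≤ (restrict L S (fiber L a)).encard := by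
  classical
  have h : ∀ e : Sym2 (GammaVertex k L (fiber L a)), ∃ B : MvPolynomial (Fin n) k,
      e ∈ (graphGammaOf L S (fiber L a)).edgeSet → B ∈ S ∧ Joins a B e := fun e => by
    by_cases he : e ∈ (graphGammaOf L S (fiber L a)).edgeSet
    · obtain ⟨-, B, hB⟩ := (mem_edgeSet_iff ha hS).1 he
      exact ⟨B, fun _ => hB⟩
    · exact ⟨0, fun h => absurd h he⟩
  choose f hf using h
  refine Set.encard_le_encard_of_injOn (f := f) (fun e he => ?_) fun e he e' he' h => ?_
  · exact (hf e he).2.mem_restrict (SimpleGraph.not_isDiag_of_mem_edgeSet _ he) (hf e he).1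
  · have h2 := (hf e' he').2
    rw [← h] at h2
    exact (hf e he).2.eq h2 (SimpleGraph.not_isDiag_of_mem_edgeSet _ he)

/-- If `Γ(S)` is connected, then `S` has at least `t - 1` binomials in the class of the fiber. -/
lemma t_le_encard_restrict {a : Fin n →₀ ℕ} (ha : outside L a ≠ 0)
    {S : Set (MvPolynomial (Fin n) k)} (hS : ∀ B ∈ S, B ∈ latticeIdeal k L)
    (hc : (graphGammaOf L S (fiber L a)).Connected) :
    t k L (fiber L a) ≤ (restrict L S (fiber L a)).encard + 1 := by
  have h := hc.card_vert_le_card_edgeSet_add_one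
  rw [t, ENat.card_eq_coe_natCard]
  refine le_trans (Nat.cast_le.2 h) ?_
  push_cast
  gcongr
  refine le_trans ?_ (encard_edgeSet_le ha hS)
  rw [← ENat.card_eq_coe_natCard]
  exact le_rfl

/-! ### Generating sets -/

/-- The graph `Γ(S)` of a generating set is connected. -/
lemma connected_graphGammaOf {a : Fin n →₀ ℕ} (ha : outside L a ≠ 0)
    {S : Set (MvPolynomial (Fin n) k)}
    (hS : ∀ B ∈ S, B ∈ latticeIdeal k L ∧ IsBinomial B) (hspan : Ideal.span S = latticeIdeal k L) :
    (graphGammaOf L S (fiber L a)).Connected := by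
  -- Quantifying over all shifts `c` makes reachability in Γ(S) an additive congruence. Once it
  -- contains the generators, it contains every pair whose binomial lies in I.
  let R : (Fin n →₀ ℕ) → (Fin n →₀ ℕ) → Prop := fun u v => toInt u - toInt v ∈ L ∧
    ∀ c (hu : u + c ∈ fiber L a) (hv : v + c ∈ fiber L a),
      (graphGammaOf L S (fiber L a)).Reachable (comp k hu) (comp k hv)
  let d : AddCon (Fin n →₀ ℕ) :=
    { r := R
      iseqv := by
        refine ⟨fun u => ⟨by simp [L.zero_mem], fun c hu hv => .rfl⟩, ?_, ?_⟩
        · rintro u v ⟨h, h'⟩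
          exact ⟨congr_symm h, fun c hu hv => (h' c hv hu).symm⟩
        · rintro u v w ⟨h1, h1'⟩ ⟨h2, h2'⟩
          refine ⟨congr_trans h1 h2, fun c hu hw => ?_⟩
          have hv : v + c ∈ fiber L a := congr_trans (congr_symm ((congr_add_right c).2 h1)) hu
          exact (h1' c hu hv).trans (h2' c hv hw)
      add' := by
        rintro u v u' v' ⟨h1, h1'⟩ ⟨h2, h2'⟩
        refine ⟨congr_trans ((congr_add_right u').2 h1) ((congr_add_left v).2 h2),
          fun c hu hv => ?_⟩
        have e1 : u + (u' + c) ∈ fiber L a := by rwa [← add_assoc]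
        have e2 : v + (u' + c) ∈ fiber L a :=
          congr_trans (congr_symm ((congr_add_right _).2 h1)) e1
        have e3 : u' + (v + c) ∈ fiber L a := by rwa [add_left_comm]
        have e4 : v' + (v + c) ∈ fiber L a := by rwa [add_left_comm, ← add_assoc]
        rw [comp_congr hu e1 (by rw [add_assoc]),
          comp_congr hv e4 (by rw [add_left_comm, ← add_assoc])]
        refine (h1' _ e1 e2).trans ?_
        rw [comp_congr e2 e3 (by rw [add_left_comm])]
        exact h2' _ e3 e4 }
  have hd : ∀ B ∈ S, ∃ u v, B = diff k u v ∧ d u v := by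
    intro B hB
    obtain ⟨hBI, u, v, -, rfl⟩ := hS B hB
    refine ⟨u, v, rfl, diff_mem_latticeIdeal_iff.1 hBI, fun c hu hv => ?_⟩
    by_cases heq : comp k hu = comp k hv
    · rw [heq]
    -- A shift supported in σ keeps the binomial in the class and yields an edge. Any other shift
    -- starts from a strictly lower class and stays inside one vertex.
    by_cases hc : outside L c = 0
    · refine ((adj_iff ha fun B hB => (hS B hB).1).2 ⟨heq, _, hB, u, v, c, rfl, hc, ?_⟩).reachable
      have hu' := hu
      have hv' := hv
      rw [add_comm] at hu' hv'
      exact ⟨hu', hv', by rw [comp_congr hu hu' (by rw [add_comm]),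
        comp_congr hv hv' (by rw [add_comm])]⟩
    · have hu' : toInt (c + u) - toInt a ∈ L := by rw [add_comm]; exact hu
      refine absurd ((comp_eq_iff ha hu hv).2 (diff_mem_add_right c (diff_mem_idealLT
        (diff_mem_latticeIdeal_iff.1 hBI) ⟨fiberLE_iff.2 ⟨c, hu'⟩, fun he => ?_⟩))) heq
      exact hc ((fiberEquiv_iff_of_congr hu').1 he)
  have : Nonempty (GammaVertex k L (fiber L a)) := ⟨comp k (self_mem_fiber a)⟩
  refine ⟨fun c e => ?_⟩
  obtain ⟨u, hu, rfl⟩ := exists_comp_eq c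
  obtain ⟨v, hv, rfl⟩ := exists_comp_eq e
  have hduv : d u v := con_of_diff_mem_span d hd (by
    rw [hspan]
    exact diff_mem_latticeIdeal_iff.2 (congr_trans hu (congr_symm hv)))
  have := hduv.2 0 (by simpa using hu) (by simpa using hv)
  simpa using this

/-- If the graph is connected by edges realized in `J ⊇ I_{<F̄}`, then `J` contains the binomials
of the class of `F`. -/
lemma diff_mem_of_preconnected {a : Fin n →₀ ℕ} (ha : outside L a ≠ 0)
    {J : Ideal (MvPolynomial (Fin n) k)} (hJ : idealLT k L (fiber L a) ≤ J)
    {H : SimpleGraph (GammaVertex k L (fiber L a))} (hH : H.Preconnected)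
    (hadj : ∀ c d, H.Adj c d → ∃ B ∈ J, Joins a B s(c, d)) {u v : Fin n →₀ ℕ}
    (hu : FiberEquiv (fiber L u) (fiber L a)) (huv : toInt u - toInt v ∈ L) :
    diff k u v ∈ J := by
  have key : ∀ c d, H.Reachable c d → ∀ u v (hu : u ∈ fiber L a) (hv : v ∈ fiber L a),
      comp k hu = c → comp k hv = d → diff k u v ∈ J := by
    rintro c d ⟨w⟩
    induction w with
    | nil =>
      intro u v hu hv h1 h2
      exact hJ ((comp_eq_iff ha hu hv).1 (h1.trans h2.symm))
    | cons hcd _ ih =>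
      intro u v hu hv h1 h2
      obtain ⟨B, hB, u', v', x, rfl, -, hu', hv', he⟩ := hadj _ _ hcd
      have hB' := diff_mem_add_left x hB
      rcases Sym2.eq_iff.1 he with ⟨hc, hd⟩ | ⟨hc, hd⟩
      · exact diff_mem_trans (hJ ((comp_eq_iff ha hu hu').1 (h1.trans hc)))
          (diff_mem_trans hB' (ih _ v hv' hv hd.symm h2))
      · exact diff_mem_trans (hJ ((comp_eq_iff ha hu hv').1 (h1.trans hc)))
          (diff_mem_trans (diff_mem_symm hB') (ih _ v hu' hv hd.symm h2))
  obtain ⟨x, hx, hxu⟩ := fiberEquiv_iff.1 hu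
  have hxv : x + v ∈ fiber L a := congr_trans ((congr_add_left x).2 (congr_symm huv)) hxu
  have h := key _ _ (hH (comp k hxu) (comp k hxv)) _ _ hxu hxv rfl rfl
  -- Here `y` undoes the shift `x` modulo L, so `z` and `y + (x + z)` agree modulo I_{<F̄}.
  obtain ⟨y, hy, hxy⟩ := exists_add_mem hx
  have shift : ∀ z, diff k z (y + (x + z)) ∈ J := fun z => by
    refine hJ (diff_mem_idealLT_of_outside_eq ha ?_ (by simp [hx, hy]))
    rw [← add_assoc, add_comm y, toInt_add, sub_add_cancel_right]
    exact L.neg_mem hxy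
  exact diff_mem_trans (shift u) (diff_mem_trans (diff_mem_add_left y h) (diff_mem_symm (shift v)))

/-- If `Q` is a property of fibers, then the binomials of `I` in the fibers with `Q` lie in
every ideal that contains the binomials of `S` with a monomial multiple in such a fiber. -/
lemma diff_mem_of_generators {S : Set (MvPolynomial (Fin n) k)}
    (hS : ∀ B ∈ S, B ∈ latticeIdeal k L ∧ IsBinomial B) (hspan : Ideal.span S = latticeIdeal k L)
    (Q : (Fin n →₀ ℕ) → Prop) (hQ : ∀ u v, toInt u - toInt v ∈ L → Q u → Q v)
    {J : Ideal (MvPolynomial (Fin n) k)}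
    (hJ : ∀ u v c, u ≠ v → diff k u v ∈ S → Q (u + c) → diff k u v ∈ J)
    {u v : Fin n →₀ ℕ} (huv : toInt u - toInt v ∈ L) (hu : Q u) : diff k u v ∈ J := by
  let R : (Fin n →₀ ℕ) → (Fin n →₀ ℕ) → Prop := fun u v => toInt u - toInt v ∈ L ∧
    ∀ c, Q (u + c) → diff k (u + c) (v + c) ∈ J
  let d : AddCon (Fin n →₀ ℕ) :=
    { r := R
      iseqv := by
        refine ⟨fun u => ⟨by simp [L.zero_mem], fun c _ => by rw [diff_self]; exact J.zero_mem⟩,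
          ?_, ?_⟩
        · rintro u v ⟨h, h'⟩
          exact ⟨congr_symm h, fun c hv => diff_mem_symm
            (h' c (hQ _ _ (congr_symm ((congr_add_right c).2 h)) hv))⟩
        · rintro u v w ⟨h1, h1'⟩ ⟨h2, h2'⟩
          exact ⟨congr_trans h1 h2, fun c hu => diff_mem_trans (h1' c hu)
            (h2' c (hQ _ _ ((congr_add_right c).2 h1) hu))⟩
      add' := by
        rintro u v u' v' ⟨h1, h1'⟩ ⟨h2, h2'⟩
        refine ⟨congr_trans ((congr_add_right u').2 h1) ((congr_add_left v).2 h2),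
          fun c hu => ?_⟩
        have e1 := h1' (u' + c) (by rwa [← add_assoc])
        have e2 := h2' (v + c) (by
          rw [add_left_comm]
          exact hQ _ _ ((congr_add_right (u' + c)).2 h1) (by rwa [← add_assoc]))
        rw [add_left_comm, add_left_comm v'] at e2
        rw [add_assoc, add_assoc]
        exact diff_mem_trans e1 e2 }
  have hd : d u v := by
    refine con_of_diff_mem_span d (X := S) ?_
      (by rw [hspan]; exact diff_mem_latticeIdeal_iff.2 huv)
    intro B hB
    obtain ⟨hBI, u, v, hne, rfl⟩ := hS B hB
    exact ⟨u, v, rfl, diff_mem_latticeIdeal_iff.1 hBI,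
      fun c hc => diff_mem_add_right c (hJ u v c hne hB hc)⟩
  simpa using hd.2 0 (by simpa using hu)

/-- A binomial of F̄ has no monomial multiple in a class strictly below F̄, so generating I_{<F̄}
never uses S_{F̄}. -/
lemma idealLT_le_span_diff_restrict {S : Set (MvPolynomial (Fin n) k)}
    (hS : ∀ B ∈ S, B ∈ latticeIdeal k L ∧ IsBinomial B) (hspan : Ideal.span S = latticeIdeal k L)
    (a : Fin n →₀ ℕ) :
    idealLT k L (fiber L a) ≤ Ideal.span (S \ restrict L S (fiber L a)) := by
  rw [idealLT, Ideal.span_le]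
  rintro _ ⟨hI, u, v, -, rfl, hlt⟩
  refine diff_mem_of_generators hS hspan (fun u => FiberLT (fiber L u) (fiber L a))
    (fun u v huv h => by rwa [← fiber_eq_of_congr huv]) (fun u v c hne hB hlt => ?_)
    (diff_mem_latticeIdeal_iff.1 hI) hlt
  refine Ideal.subset_span ⟨hB, ?_⟩
  rintro ⟨-, u', v', -, heq, hF⟩
  have hE := fiber_mem_fiberClass_iff.1 hF
  have huu' : fiber L u = fiber L u' := by
    have huv := diff_mem_latticeIdeal_iff.1 (hS _ hB).1
    rcases Sym2.eq_iff.1 (diff_eq_diff hne heq) with ⟨rfl, -⟩ | ⟨-, rfl⟩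
    · rfl
    · exact fiber_eq_of_congr huv
  rw [← huu'] at hE
  apply hlt.2
  obtain ⟨x, hx⟩ := fiberLE_iff.1 hlt.1
  have h1 : toInt ((x + c) + u) - toInt a ∈ L := by rwa [add_assoc, add_comm c]
  have h2 := (fiberEquiv_iff_of_congr h1).1 hE
  rw [outside_add] at h2
  exact (fiberEquiv_iff_of_congr hx).2 (add_eq_zero.1 h2).1

/-! ### The pure part -/

lemma pureLattice_le : pureLattice L ≤ L :=
  (AddSubgroup.closure_le L).2 fun _ h => h.1

lemma eq_zero_of_mem_pureLattice {w : Fin n → ℤ} (hw : w ∈ pureLattice L) {i : Fin n}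
    (hi : i ∉ sigma L) : w i = 0 := by
  have : pureLattice L ≤ (Pi.evalAddMonoidHom (fun _ : Fin n => ℤ) i).ker :=
    (AddSubgroup.closure_le _).2 fun w hw => by
      by_contra h
      exact hi ⟨w, hw, h⟩
  exact this hw

/-- Completing `u` by `y` to an element of L completes `v` as well, and the difference is one of two
elements of L⁺. -/
lemma sub_mem_pureLattice {u v : Fin n →₀ ℕ} (huv : toInt u - toInt v ∈ L)
    (hu : outside L u = 0) : toInt u - toInt v ∈ pureLattice L := by
  obtain ⟨y, -, hm⟩ := exists_add_mem hu
  have hm' : toInt (v + y) ∈ L := by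
    have := L.sub_mem hm huv
    rw [toInt_add] at this ⊢
    convert this using 1
    abel
  have h1 : toInt (u + y) ∈ pureLattice L :=
    AddSubgroup.subset_closure ⟨hm, fun _ => Int.natCast_nonneg _⟩
  have h2 : toInt (v + y) ∈ pureLattice L :=
    AddSubgroup.subset_closure ⟨hm', fun _ => Int.natCast_nonneg _⟩
  simpa using sub_mem h1 h2

lemma exists_diff_eq_of_mem_pureLattice {u v : Fin n →₀ ℕ}
    (h : toInt u - toInt v ∈ pureLattice L) :
    ∃ c u' v', u = c + u' ∧ v = c + v' ∧ outside L u' = 0 := by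
  refine ⟨u ⊓ v, u - u ⊓ v, v - u ⊓ v, (add_tsub_cancel_of_le inf_le_left).symm,
    (add_tsub_cancel_of_le inf_le_right).symm, outside_eq_zero_iff.2 fun i hi => ?_⟩
  have := eq_zero_of_mem_pureLattice h hi
  simp only [toInt, Pi.sub_apply] at this
  simp only [Finsupp.tsub_apply, Finsupp.inf_apply]
  omega

lemma restrict_zero_subset {S : Set (MvPolynomial (Fin n) k)}
    (hS : ∀ B ∈ S, B ∈ latticeIdeal k L) :
    restrict L S (fiber L 0) ⊆ latticeIdeal k (pureLattice L) := by
  rintro _ ⟨hB, u, v, -, rfl, hF⟩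
  exact diff_mem_latticeIdeal_iff.2 (sub_mem_pureLattice (diff_mem_latticeIdeal_iff.1 (hS _ hB))
    (fiberEquiv_zero_iff.1 (fiber_mem_fiberClass_iff.1 hF)))

/-- Up to a monomial factor, the generators of I_{L_pure} lie in the class of 1. Only generators of
that class divide into it, since a divisor of a monomial supported in σ is supported in σ. -/
lemma latticeIdeal_pureLattice_eq {S : Set (MvPolynomial (Fin n) k)}
    (hS : ∀ B ∈ S, B ∈ latticeIdeal k L ∧ IsBinomial B)
    (hspan : Ideal.span S = latticeIdeal k L) :
    latticeIdeal k (pureLattice L) = Ideal.span (restrict L S (fiber L 0)) := by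
  apply le_antisymm
  · rw [latticeIdeal, Ideal.span_le]
    rintro _ ⟨u, v, huv, rfl⟩
    obtain ⟨c, u, v, rfl, rfl, hu⟩ := exists_diff_eq_of_mem_pureLattice huv
    refine diff_mem_add_left c (diff_mem_of_generators hS hspan (fun u => outside L u = 0)
      (fun u v h => outside_eq_zero_of_congr h) ?_
      ((congr_add_left c).1 (pureLattice_le huv)) hu)
    intro u v c hne hB h
    rw [outside_add] at h
    exact Ideal.subset_span ⟨hB, u, v, hne, rfl,
      fiber_mem_fiberClass_iff.2 (fiberEquiv_zero_iff.2 (add_eq_zero.1 h).1)⟩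
  · exact Ideal.span_le.2 (restrict_zero_subset fun B hB => (hS B hB).1)

/-! ### The number of generators of I_{L_pure} and the rank of L_pure. -/

/-- The positive part of an integral vector. -/
noncomputable def posVec (l : Fin n → ℤ) : Fin n →₀ ℕ :=
  Finsupp.equivFunOnFinite.symm fun i => (l i).toNat

lemma posVec_apply (l : Fin n → ℤ) (i : Fin n) : posVec l i = (l i).toNat := rfl

lemma toInt_posVec_sub (l : Fin n → ℤ) : toInt (posVec l) - toInt (posVec (-l)) = l := by
  ext i
  simp only [toInt, Pi.sub_apply, posVec_apply, Pi.neg_apply]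
  omega

lemma exists_eq_add_posVec {u v : Fin n →₀ ℕ} {l : Fin n → ℤ} (h : toInt u - toInt v = l) :
    ∃ c, u = c + posVec l ∧ v = c + posVec (-l) := by
  subst h
  refine ⟨u - posVec (toInt u - toInt v), ?_, ?_⟩ <;> ext i <;>
    simp only [toInt, Pi.sub_apply, posVec_apply, Pi.neg_apply, Finsupp.add_apply,
      Finsupp.tsub_apply] <;> omega

/-- The exponent differences of X span a lattice whose congruence holds for every binomial in the
ideal of X. That lattice contains M, so its number of generators bounds the rank. -/
lemma finrank_le_encard (M : AddSubgroup (Fin n → ℤ)) {X : Set (MvPolynomial (Fin n) k)}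
    (hX : ∀ B ∈ X, IsBinomial B) (hle : latticeIdeal k M ≤ Ideal.span X) :
    (Module.finrank ℤ M : ℕ∞) ≤ X.encard := by
  classical
  rcases X.finite_or_infinite with hfin | hinf
  swap
  · simp [hinf.encard_eq]
  have hX' : ∀ B : MvPolynomial (Fin n) k, ∃ l : Fin n → ℤ, B ∈ X →
      ∃ u v, B = diff k u v ∧ toInt u - toInt v = l := fun B => by
    by_cases hB : B ∈ X
    · obtain ⟨u, v, -, rfl⟩ := hX B hB
      exact ⟨_, fun _ => ⟨u, v, rfl, rfl⟩⟩
    · exact ⟨0, fun h => absurd h hB⟩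
  choose f hf using hX'
  set V : Finset (Fin n → ℤ) := hfin.toFinset.image f with hV
  let N : Submodule ℤ (Fin n → ℤ) := Submodule.span ℤ V
  have hMN : ∀ l ∈ M, l ∈ N := by
    intro l hl
    have h1 : diff k (posVec l) (posVec (-l)) ∈ Ideal.span X :=
      hle (diff_mem_latticeIdeal_iff.2 (by rwa [toInt_posVec_sub]))
    have h2 := con_of_diff_mem_span (latticeCon N.toAddSubgroup) (fun B hB => by
      obtain ⟨u, v, rfl, h⟩ := hf B hB
      refine ⟨u, v, rfl, ?_⟩
      change toInt u - toInt v ∈ N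
      rw [h]
      exact Submodule.subset_span (by simpa [hV] using ⟨_, hB, rfl⟩)) h1
    change toInt (posVec l) - toInt (posVec (-l)) ∈ N at h2
    rwa [toInt_posVec_sub] at h2
  let g : M →+ N :=
    { toFun := fun l => ⟨l, hMN l l.2⟩
      map_zero' := rfl
      map_add' := fun _ _ => rfl }
  have hg : Function.Injective g.toIntLinearMap := fun x y h =>
    Subtype.ext (congrArg (Subtype.val : N → _) h)
  have h1 := LinearMap.finrank_le_finrank_of_injective hg
  have h2 : Module.finrank ℤ N ≤ V.card := finrank_span_finset_le_card V
  have h3 : V.card ≤ hfin.toFinset.card := Finset.card_image_le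
  rw [hfin.encard_eq_coe_toFinset_card]
  exact_mod_cast h1.trans (h2.trans h3)

/-- The ideal of a lattice of vectors supported in `s` lies in `J` if `J` contains the binomials
of generators of the lattice and some `1 - x^p` with `p` positive on `s`. -/
lemma diff_mem_of_basis {ι : Type*} [Finite ι] {M : AddSubgroup (Fin n → ℤ)}
    {b : ι → (Fin n → ℤ)} (hMb : ∀ l ∈ M, l ∈ AddSubgroup.closure (Set.range b))
    {s : Set (Fin n)} (hs : ∀ i, ∀ j ∉ s, b i j = 0) {p : Fin n →₀ ℕ} (hp : ∀ j ∈ s, p j ≠ 0)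
    {J : Ideal (MvPolynomial (Fin n) k)} (hpJ : diff k 0 p ∈ J)
    (hb : ∀ i, diff k (posVec (b i)) (posVec (-b i)) ∈ J) :
    latticeIdeal k M ≤ J := by
  have hnp : ∀ (m : ℕ) (u : Fin n →₀ ℕ), diff k u (u + m • p) ∈ J := by
    intro m u
    induction m with
    | zero => simp [diff_self]
    | succ m ih =>
      have := diff_mem_add_left (u + m • p) hpJ
      rw [add_zero, add_assoc, ← succ_nsmul] at this
      exact diff_mem_trans ih this
  -- Vanishing outside `s` is part of the condition because multiples of `p` can only compensate
  -- negative entries on `s`.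
  let H : AddSubgroup (Fin n → ℤ) :=
    { carrier := {l | (∀ j ∉ s, l j = 0) ∧ ∀ u v, toInt u - toInt v = l → diff k u v ∈ J}
      zero_mem' := by
        refine ⟨fun _ _ => rfl, fun u v h => ?_⟩
        obtain ⟨c, rfl, rfl⟩ := exists_eq_add_posVec h
        rw [neg_zero, diff_self]
        exact J.zero_mem
      neg_mem' := by
        rintro l ⟨h0, h⟩
        refine ⟨fun j hj => by simp [h0 j hj], fun u v huv => diff_mem_symm (h v u ?_)⟩
        rw [← neg_sub, huv, neg_neg]
      add_mem' := by
        rintro l l' ⟨h0, h⟩ ⟨h0', h'⟩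
        refine ⟨fun j hj => by simp [h0 j hj, h0' j hj], fun u v huv => ?_⟩
        -- For `m` this large, `v + m • p + l'` is nonnegative and serves as the intermediate
        -- monomial `w`. The factors `x^(m • p)` are free modulo J.
        obtain ⟨m, hm⟩ : ∃ m : ℕ, ∀ j, (l' j).natAbs ≤ m :=
          ⟨∑ j, (l' j).natAbs, fun j => Finset.single_le_sum (f := fun j => (l' j).natAbs)
            (fun _ _ => Nat.zero_le _) (Finset.mem_univ j)⟩
        obtain ⟨w, hw⟩ : ∃ w, toInt w = toInt (v + m • p) + l' := by
          refine exists_toInt_eq fun j => ?_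
          simp only [toInt, Pi.add_apply, Finsupp.add_apply, Finsupp.smul_apply, smul_eq_mul]
          by_cases hj : j ∈ s
          · have h1 := hm j
            have h2 : m ≤ m * p j := Nat.le_mul_of_pos_right m (Nat.pos_of_ne_zero (hp j hj))
            omega
          · rw [h0' j hj]
            positivity
        have e1 : diff k (u + m • p) w ∈ J := h _ _ (by
          rw [hw, toInt_add, toInt_add]
          rw [sub_eq_iff_eq_add] at huv
          rw [huv]
          abel)
        have e2 : diff k w (v + m • p) ∈ J := h' _ _ (by rw [hw]; abel)
        exact diff_mem_trans (hnp m u) (diff_mem_trans e1 (diff_mem_trans e2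
          (diff_mem_symm (hnp m v)))) }
  have hH : AddSubgroup.closure (Set.range b) ≤ H := by
    rw [AddSubgroup.closure_le]
    rintro _ ⟨i, rfl⟩
    refine ⟨hs i, fun u v h => ?_⟩
    obtain ⟨c, rfl, rfl⟩ := exists_eq_add_posVec h
    exact diff_mem_add_left c (hb i)
  rw [latticeIdeal, Ideal.span_le]
  rintro _ ⟨u, v, huv, rfl⟩
  exact (hH (hMb _ huv)).2 u v rfl

lemma posVec_eq_zero {l : Fin n → ℤ} (h : ∀ i, l i ≤ 0) : posVec l = 0 := by
  ext i
  have := h i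
  simp only [posVec_apply, Finsupp.coe_zero, Pi.zero_apply]
  omega

/-- `L_pure` has a basis with a member that has constant sign and support `σ`, unless it is
zero. -/
lemma exists_basis_pureLattice (h : pureLattice L ≠ ⊥) :
    ∃ b : Fin (Module.finrank ℤ (pureLattice L)) → (Fin n → ℤ),
      (∀ i, b i ∈ pureLattice L ∧ b i ≠ 0) ∧
      (∀ l ∈ pureLattice L, l ∈ AddSubgroup.closure (Set.range b)) ∧
      ∃ j, (∀ i ∈ sigma L, b j i ≠ 0) ∧ ((∀ i, 0 ≤ b j i) ∨ ∀ i, b j i ≤ 0) := by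
  obtain ⟨w, hw, hge⟩ := exists_mem_ge L (Finsupp.equivFunOnFinite.symm fun _ => 1)
  have hge' : ∀ i ∈ sigma L, 1 ≤ w i := hge
  have hwp : toInt w ∈ AddSubgroup.toIntSubmodule (pureLattice L) :=
    AddSubgroup.subset_closure ⟨hw, fun _ => Int.natCast_nonneg _⟩
  set x : AddSubgroup.toIntSubmodule (pureLattice L) := ⟨toInt w, hwp⟩ with hx
  have hx0 : x ≠ 0 := by
    intro h0
    have hw0 : ∀ i, w i = 0 := fun i => by
      simpa [hx, toInt] using congrFun (congrArg Subtype.val h0) i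
    apply h
    rw [eq_bot_iff]
    intro l hl
    ext i
    refine eq_zero_of_mem_pureLattice hl fun hi => ?_
    have := hge' i hi
    rw [hw0 i] at this
    omega
  -- The Smith normal form of ℤ`x` in L_pure gives a basis of L_pure with one member proportional to
  -- `w`, which is positive on all of σ.
  let N := Submodule.span ℤ {x}
  have hxN : x ∈ N := Submodule.mem_span_singleton_self x
  have hN : Nontrivial N := ⟨⟨x, hxN⟩, 0, fun h0 => hx0 (congrArg Subtype.val h0)⟩
  obtain ⟨m, bM, bN, f, a, snf⟩ :=
    N.smithNormalForm (Module.finBasis ℤ (AddSubgroup.toIntSubmodule (pureLattice L)))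
  obtain ⟨i₀⟩ := bN.index_nonempty
  obtain ⟨z, hz⟩ := Submodule.mem_span_singleton.1 (bN i₀).2
  have hb0 : (bN i₀ : AddSubgroup.toIntSubmodule (pureLattice L)) ≠ 0 := fun h0 =>
    bN.ne_zero i₀ (Subtype.ext h0)
  have hz0 : z ≠ 0 := by
    rintro rfl
    exact hb0 (by rw [← hz, zero_smul])
  have ha0 : a i₀ ≠ 0 := by
    intro h0
    exact hb0 (by rw [snf, h0, zero_smul])
  obtain ⟨b, hb⟩ : ∃ b : Fin (Module.finrank ℤ (pureLattice L)) → (Fin n → ℤ),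
      ∀ i, b i = (bM i : Fin n → ℤ) := ⟨_, fun _ => rfl⟩
  obtain ⟨j, hj⟩ : ∃ j, b j = (bM (f i₀) : Fin n → ℤ) := ⟨f i₀, hb _⟩
  have hmul : ∀ i, z * w i = a i₀ * b j i := fun i => by
    have := congrFun (congrArg Subtype.val (hz.trans (snf i₀))) i
    rw [hj]
    simpa [hx, toInt] using this
  refine ⟨b, fun i => ⟨?_, fun h0 => ?_⟩, fun l hl => ?_, j, fun i hi h0 => ?_, ?_⟩
  · rw [hb]
    exact (bM i).2
  · rw [hb] at h0
    exact bM.ne_zero i (Subtype.ext h0)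
  · have h1 := congrArg Subtype.val (bM.sum_repr ⟨l, hl⟩)
    rw [Submodule.coe_sum] at h1
    rw [← show _ = l from h1]
    refine sum_mem fun i _ => zsmul_mem (AddSubgroup.subset_closure ?_) _
    exact ⟨i, hb i⟩
  · have h1 := hmul i
    rw [h0, mul_zero] at h1
    rcases mul_eq_zero.1 h1 with h2 | h2
    · exact hz0 h2
    · have := hge' i hi
      omega
  -- Multiplying the relation by `a i₀` gives `b j` a positive coefficient, so its sign is that of
  -- `a i₀ * z`.
  · have h2 : 0 < a i₀ * a i₀ := mul_self_pos.2 ha0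
    have hmul' : ∀ i, a i₀ * a i₀ * b j i = a i₀ * z * w i := fun i => by
      rw [mul_assoc, ← hmul i, mul_assoc]
    rcases le_total 0 (a i₀ * z) with h3 | h3
    · refine .inl fun i => nonneg_of_mul_nonneg_right ?_ h2
      rw [hmul' i]
      positivity
    · refine .inr fun i => nonpos_of_mul_nonpos_right ?_ h2
      rw [hmul' i]
      exact mul_nonpos_of_nonpos_of_nonneg h3 (Int.natCast_nonneg _)

/-- `I_{L_pure}` is generated by `rank L_pure` binomials. -/
lemma exists_generators_pureLattice (k : Type*) [Field k] (L : AddSubgroup (Fin n → ℤ)) :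
    ∃ P : Set (MvPolynomial (Fin n) k),
      P.encard ≤ (Module.finrank ℤ (pureLattice L) : ℕ∞) ∧
      (∀ B ∈ P, B ∈ latticeIdeal k (pureLattice L) ∧ IsBinomial B) ∧
      latticeIdeal k (pureLattice L) ≤ Ideal.span P := by
  by_cases h : pureLattice L = ⊥
  · refine ⟨∅, by simp, by simp, ?_⟩
    rw [latticeIdeal, Ideal.span_le]
    rintro _ ⟨u, v, huv, rfl⟩
    rw [h, AddSubgroup.mem_bot, sub_eq_zero] at huv
    have : u = v := by
      ext i
      simpa [toInt] using congrFun huv i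
    rw [this, diff_self]
    exact zero_mem _
  obtain ⟨b, hb, hspan, j, hj, hsign⟩ := exists_basis_pureLattice h
  let g : Fin (Module.finrank ℤ (pureLattice L)) → MvPolynomial (Fin n) k := fun i =>
    diff k (posVec (b i)) (posVec (-(b i)))
  have hg : ∀ i, g i ∈ Ideal.span (Set.range g) := fun i => Ideal.subset_span ⟨i, rfl⟩
  refine ⟨Set.range g, ?_, ?_, ?_⟩
  · rw [← Set.image_univ]
    refine (Set.encard_image_le _ _).trans ?_
    simp
  · rintro _ ⟨i, rfl⟩
    refine ⟨diff_mem_latticeIdeal_iff.2 ?_, _, _, fun heq => ?_, rfl⟩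
    · rw [toInt_posVec_sub]
      exact (hb i).1
    · have h0 := toInt_posVec_sub (b i)
      rw [heq, sub_self] at h0
      exact (hb i).2 h0.symm
  -- The vector `p` is the absolute value of `b j`. By constant sign, one of the two parts is zero
  -- and `g j` is `1 - x^p` up to sign.
  · refine diff_mem_of_basis (b := b) (s := sigma L)
      (p := posVec (b j) + posVec (-(b j))) hspan
      (fun i _ hi => eq_zero_of_mem_pureLattice (hb i).1 hi) (fun i hi h0 => hj i hi ?_) ?_ hg
    · simp only [Finsupp.add_apply, posVec_apply, Pi.neg_apply] at h0
      omega
    · have h1 := hg j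
      simp only [g] at h1
      rcases hsign with hpos | hneg
      · rw [posVec_eq_zero (l := -(b j)) fun i => by simpa using hpos i] at h1 ⊢
        rw [add_zero]
        exact diff_mem_symm h1
      · rw [posVec_eq_zero hneg] at h1 ⊢
        rwa [zero_add]

/-! ### Classes of binomials -/

lemma restrict_subset (S : Set (MvPolynomial (Fin n) k)) (F : Set (Fin n →₀ ℕ)) :
    restrict L S F ⊆ S := fun _ h => h.1

lemma restrict_congr (S : Set (MvPolynomial (Fin n) k)) {a b : Fin n →₀ ℕ}
    (h : FiberEquiv (fiber L a) (fiber L b)) :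
    restrict L S (fiber L a) = restrict L S (fiber L b) := by
  simp only [restrict, fiberClass_eq h]

/-- The class of the fiber of a binomial. -/
def classOf (L : AddSubgroup (Fin n → ℤ)) (B : MvPolynomial (Fin n) k) :
    Set (Set (Fin n →₀ ℕ)) :=
  {G | ∃ u v, u ≠ v ∧ B = diff k u v ∧ G ∈ fiberClass L (fiber L u)}

lemma classOf_diff {u v : Fin n →₀ ℕ} (hne : u ≠ v) (h : toInt u - toInt v ∈ L) :
    classOf L (diff k u v) = fiberClass L (fiber L u) := by
  apply Set.Subset.antisymm
  · rintro G ⟨u', v', -, heq, hG⟩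
    rcases Sym2.eq_iff.1 (diff_eq_diff hne heq) with ⟨rfl, -⟩ | ⟨-, rfl⟩
    · exact hG
    · rwa [fiber_eq_of_congr h]
  · exact fun G hG => ⟨u, v, hne, rfl, hG⟩

lemma fiberClass_eq_iff {a b : Fin n →₀ ℕ} :
    fiberClass L (fiber L a) = fiberClass L (fiber L b) ↔ FiberEquiv (fiber L a) (fiber L b) :=
  ⟨fun h => fiber_mem_fiberClass_iff.1 (h ▸ fiber_mem_fiberClass_iff.2 (fiberEquiv_refl a)),
    fiberClass_eq⟩

/-- This presents the sets S_{F̄} as parts of one partition, the form needed by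
`encard_le_of_fibers`. -/
lemma restrict_eq_classOf {S : Set (MvPolynomial (Fin n) k)}
    (hS : ∀ B ∈ S, B ∈ latticeIdeal k L ∧ IsBinomial B) (a : Fin n →₀ ℕ) :
    restrict L S (fiber L a) = S ∩ classOf L ⁻¹' {fiberClass L (fiber L a)} := by
  ext B
  constructor
  · rintro ⟨hB, u, v, hne, rfl, hF⟩
    refine ⟨hB, ?_⟩
    rw [Set.mem_preimage, Set.mem_singleton_iff,
      classOf_diff hne (diff_mem_latticeIdeal_iff.1 (hS _ hB).1)]
    exact fiberClass_eq (fiber_mem_fiberClass_iff.1 hF)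
  · rintro ⟨hB, hc⟩
    obtain ⟨hBI, u, v, hne, rfl⟩ := hS B hB
    rw [Set.mem_preimage, Set.mem_singleton_iff,
      classOf_diff hne (diff_mem_latticeIdeal_iff.1 hBI), fiberClass_eq_iff] at hc
    exact ⟨hB, u, v, hne, rfl, fiber_mem_fiberClass_iff.2 hc⟩

lemma exists_mem_restrict {S : Set (MvPolynomial (Fin n) k)}
    (hS : ∀ B ∈ S, B ∈ latticeIdeal k L ∧ IsBinomial B) {B : MvPolynomial (Fin n) k}
    (hB : B ∈ S) : ∃ a, B ∈ restrict L S (fiber L a) := by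
  obtain ⟨-, u, v, hne, rfl⟩ := hS B hB
  exact ⟨u, hB, u, v, hne, rfl, fiber_mem_fiberClass_iff.2 (fiberEquiv_refl u)⟩

/-- Cardinalities compare if they compare along the parts of a partition. -/
lemma encard_le_of_fibers {α β : Type*} [Nonempty α] (κ : α → β) {S T : Set α}
    (hfin : ∀ x ∈ S, (S ∩ κ ⁻¹' {κ x}).Finite)
    (hle : ∀ x ∈ S, (S ∩ κ ⁻¹' {κ x}).encard ≤ (T ∩ κ ⁻¹' {κ x}).encard) :
    S.encard ≤ T.encard := by
  have h : ∀ c : β, ∃ f : α → α, c ∈ κ '' S →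
      Set.MapsTo f (S ∩ κ ⁻¹' {c}) (T ∩ κ ⁻¹' {c}) ∧ Set.InjOn f (S ∩ κ ⁻¹' {c}) := by
    intro c
    by_cases hc : c ∈ κ '' S
    · obtain ⟨x, hx, rfl⟩ := hc
      obtain ⟨f, hf, hinj⟩ := (hfin x hx).exists_injOn_of_encard_le (hle x hx)
      exact ⟨f, fun _ => ⟨hf, hinj⟩⟩
    · exact ⟨id, fun h => absurd h hc⟩
  choose f hf using h
  refine Set.encard_le_encard_of_injOn (f := fun x => f (κ x) x)
    (fun x hx => ((hf _ ⟨x, hx, rfl⟩).1 ⟨hx, rfl⟩).1) fun x hx y hy hxy => ?_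
  have h1 : κ (f (κ x) x) = κ x := ((hf _ ⟨x, hx, rfl⟩).1 ⟨hx, rfl⟩).2
  have h2 : κ (f (κ y) y) = κ y := ((hf _ ⟨y, hy, rfl⟩).1 ⟨hy, rfl⟩).2
  have h3 : κ x = κ y := by rw [← h1, ← h2]; exact congrArg κ hxy
  simp only [h3] at hxy
  exact (hf _ ⟨y, hy, rfl⟩).2 ⟨hx, h3⟩ ⟨hy, rfl⟩ hxy

lemma t_ne_top (a : Fin n →₀ ℕ) : t k L (fiber L a) ≠ ⊤ := by
  rw [t, ENat.card_eq_coe_natCard]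
  exact ENat.natCast_ne_top _

lemma isTree_graphGammaOf_of_outside_eq_zero {a : Fin n →₀ ℕ} (ha : outside L a = 0)
    (S : Set (MvPolynomial (Fin n) k)) : (graphGammaOf L S (fiber L a)).IsTree := by
  have : Nonempty (GammaVertex k L (fiber L a)) := ⟨comp k (self_mem_fiber a)⟩
  have hs : Subsingleton (GammaVertex k L (fiber L a)) := by
    refine ⟨fun c d => ?_⟩
    obtain ⟨u, hu, rfl⟩ := exists_comp_eq c
    obtain ⟨v, hv, rfl⟩ := exists_comp_eq d
    exact comp_congr hu hv (by
      rw [outside_eq_zero_of_congr (congr_symm hu) ha, outside_eq_zero_of_congr (congr_symm hv) ha])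
  exact SimpleGraph.IsTree.of_subsingleton

/-! ### Generation from connected graphs, and exchange within a class. -/

/-- The degree outside `σ` is bounded on a fiber. -/
lemma exists_sum_outside_lt (a : Fin n →₀ ℕ) [Fintype {i : Fin n // i ∉ sigma L}] :
    ∃ N : ℕ, ∀ b ∈ fiber L a, ∑ i, outside L b i < N := by
  obtain ⟨N, hN⟩ := ((finite_outside_image (L := L) a).image fun p => ∑ i, p i).bddAbove
  exact ⟨N + 1, fun b hb => Nat.lt_succ_of_le (hN ⟨_, ⟨b, hb, rfl⟩, rfl⟩)⟩

/-- A set of binomials with connected graphs `Γ` that generates the pure part generates `I`. -/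
lemma span_eq_of_connected {S : Set (MvPolynomial (Fin n) k)}
    (hS : ∀ B ∈ S, B ∈ latticeIdeal k L)
    (hc : ∀ a, outside L a ≠ 0 → (graphGammaOf L S (fiber L a)).Connected)
    (hp : latticeIdeal k (pureLattice L) ≤ Ideal.span (restrict L S (fiber L 0))) :
    Ideal.span S = latticeIdeal k L := by
  classical
  refine le_antisymm (Ideal.span_le.2 hS) ?_
  -- Induction on a strict bound for the degree outside σ over the whole fiber. The bound 0 is
  -- vacuous because fibers are nonempty.
  have key : ∀ (N : ℕ) (a : Fin n →₀ ℕ), (∀ b ∈ fiber L a, ∑ i, outside L b i < N) →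
      ∀ v, toInt a - toInt v ∈ L → diff k a v ∈ Ideal.span S := by
    intro N
    induction N with
    | zero => exact fun a h => absurd (h a (self_mem_fiber a)) (Nat.not_lt_zero _)
    | succ N ih =>
      intro a hN v hv
      by_cases ha : outside L a = 0
      · exact Ideal.span_mono (restrict_subset S _)
          (hp (diff_mem_latticeIdeal_iff.2 (sub_mem_pureLattice hv ha)))
      refine diff_mem_of_preconnected ha ?_ (hc a ha).preconnected (fun c d hcd => ?_)
        (fiberEquiv_refl a) hv
      · rw [idealLT, Ideal.span_le]
        rintro _ ⟨hI, u, w, -, rfl, hle, hne⟩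
        obtain ⟨c, hcu⟩ := fiberLE_iff.1 hle
        refine ih u (fun b hb => ?_) w (diff_mem_latticeIdeal_iff.1 hI)
        have h1 := hN (c + b) (congr_trans ((congr_add_left c).2 hb) hcu)
        -- Strictness of the order forces `c` to have positive degree outside σ, so the lower fiber
        -- satisfies the bound `N`.
        have h2 : 0 < ∑ i, outside L c i := by
          refine Nat.pos_of_ne_zero fun h0 => hne ((fiberEquiv_iff_of_congr hcu).2 ?_)
          rw [Finset.sum_eq_zero_iff] at h0
          exact funext fun i => h0 i (Finset.mem_univ i)
        rw [outside_add] at h1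
        simp only [Pi.add_apply, Finset.sum_add_distrib] at h1
        omega
      · obtain ⟨-, B, hB, hj⟩ := (adj_iff ha hS).1 hcd
        exact ⟨B, Ideal.subset_span hB, hj⟩
  rw [latticeIdeal, Ideal.span_le]
  rintro _ ⟨u, v, huv, rfl⟩
  obtain ⟨N, hN⟩ := exists_sum_outside_lt (L := L) u
  exact key N u hN v huv

/-- The binomials of one class in a generating set may be exchanged for others that generate them
together with the remaining ones. -/
lemma span_exchange {S P : Set (MvPolynomial (Fin n) k)} {a : Fin n →₀ ℕ}
    (hspan : Ideal.span S = latticeIdeal k L) (hP : ∀ B ∈ P, B ∈ latticeIdeal k L)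
    (h : ∀ B ∈ restrict L S (fiber L a),
      B ∈ Ideal.span (S \ restrict L S (fiber L a) ∪ P)) :
    Ideal.span (S \ restrict L S (fiber L a) ∪ P) = latticeIdeal k L := by
  apply le_antisymm
  · refine Ideal.span_le.2 (Set.union_subset (fun B hB => ?_) hP)
    rw [← hspan]
    exact Ideal.subset_span hB.1
  · rw [← hspan, Ideal.span_le]
    intro B hB
    by_cases hr : B ∈ restrict L S (fiber L a)
    · exact h B hr
    · exact Ideal.subset_span (.inl ⟨hB, hr⟩)

/-! ### Minimal generating systems and Markov bases. -/

/-- By Noetherianity a finite subset already generates, and minimality makes it everything. -/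
lemma IsMinimalBinomialGeneratingSet.finite {S : Set (MvPolynomial (Fin n) k)}
    (h : IsMinimalBinomialGeneratingSet L S) : S.Finite := by
  obtain ⟨s, hs, heq⟩ := (Submodule.fg_span_iff_fg_span_finset_subset S).1
    (IsNoetherian.noetherian (Submodule.span (MvPolynomial (Fin n) k) S))
  by_cases hss : (s : Set (MvPolynomial (Fin n) k)) = S
  · rw [← hss]
    exact s.finite_toSet
  · exact absurd (heq.symm.trans h.2.1) (h.2.2 _ (hs.ssubset_of_ne hss))

lemma exists_minimal_subset {S : Set (MvPolynomial (Fin n) k)} (hfin : S.Finite)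
    (hS : ∀ B ∈ S, IsBinomial B) (hspan : Ideal.span S = latticeIdeal k L) :
    ∃ T ⊆ S, IsMinimalBinomialGeneratingSet L T := by
  obtain ⟨T, hT, hmin⟩ := (hfin.finite_subsets.subset
    (Set.sep_subset _ fun T => Ideal.span T = latticeIdeal k L)).exists_minimal
    ⟨S, Set.Subset.refl S, hspan⟩
  exact ⟨T, hT.1, fun B hB => hS B (hT.1 hB), hT.2, fun U hU hUs =>
    hU.2 (hmin ⟨hU.1.trans hT.1, hUs⟩ hU.1)⟩

lemma IsMinimalBinomialGeneratingSet.mem {S : Set (MvPolynomial (Fin n) k)}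
    (h : IsMinimalBinomialGeneratingSet L S) {B : MvPolynomial (Fin n) k} (hB : B ∈ S) :
    B ∈ latticeIdeal k L ∧ IsBinomial B :=
  ⟨h.2.1 ▸ Ideal.subset_span hB, h.1 B hB⟩

/-- A minimal generating set gives spanning trees. -/
lemma IsMinimalBinomialGeneratingSet.isTree {S : Set (MvPolynomial (Fin n) k)}
    (h : IsMinimalBinomialGeneratingSet L S) {a : Fin n →₀ ℕ} (ha : outside L a ≠ 0) :
    (graphGammaOf L S (fiber L a)).IsTree ∧
      (restrict L S (fiber L a)).encard + 1 = t k L (fiber L a) := by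
  have hS : ∀ B ∈ S, B ∈ latticeIdeal k L ∧ IsBinomial B := fun B hB => h.mem hB
  have hSI : ∀ B ∈ S, B ∈ latticeIdeal k L := fun B hB => (h.mem hB).1
  have hconn := connected_graphGammaOf ha hS h.2.1
  -- One binomial per edge of a spanning tree, together with the other classes, still generates. By
  -- minimality the class contains nothing else.
  obtain ⟨T, hT, hTree⟩ := hconn.exists_isTree_le
  have hex : ∀ e : Sym2 (GammaVertex k L (fiber L a)), ∃ B : MvPolynomial (Fin n) k,
      e ∈ T.edgeSet → B ∈ S ∧ Joins a B e := fun e => by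
    by_cases he : e ∈ T.edgeSet
    · obtain ⟨-, B, hB⟩ := (mem_edgeSet_iff ha hSI).1 (SimpleGraph.edgeSet_mono hT he)
      exact ⟨B, fun _ => hB⟩
    · exact ⟨0, fun h => absurd h he⟩
  choose f hf using hex
  have hPS : ∀ B ∈ f '' T.edgeSet, B ∈ S := by
    rintro _ ⟨e, he, rfl⟩
    exact (hf e he).1
  have hspan := span_exchange (P := f '' T.edgeSet) (a := a) h.2.1
    (fun B hB => hSI B (hPS B hB)) (by
      rintro _ ⟨hB, u, v, -, rfl, hF⟩
      refine diff_mem_of_preconnected ha ((idealLT_le_span_diff_restrict hS h.2.1 a).trans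
        (Ideal.span_mono Set.subset_union_left)) hTree.connected.preconnected
        (fun c d hcd => ?_) (fiber_mem_fiberClass_iff.1 hF) (diff_mem_latticeIdeal_iff.1 (hSI _ hB))
      exact ⟨_, Ideal.subset_span (.inr ⟨s(c, d), hcd, rfl⟩), (hf s(c, d) hcd).2⟩)
  have hsub : S \ restrict L S (fiber L a) ∪ f '' T.edgeSet ⊆ S :=
    Set.union_subset Set.sdiff_subset hPS
  have heq : S \ restrict L S (fiber L a) ∪ f '' T.edgeSet = S := by
    by_contra hne
    exact h.2.2 _ (hsub.ssubset_of_ne hne) hspan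
  have hrP : restrict L S (fiber L a) ⊆ f '' T.edgeSet := fun B hB => by
    have hBS : B ∈ S := hB.1
    rw [← heq] at hBS
    exact hBS.resolve_left fun h => h.2 hB
  have hle : (restrict L S (fiber L a)).encard ≤ T.edgeSet.encard :=
    (Set.encard_le_encard hrP).trans (Set.encard_image_le _ _)
  -- Γ(S) has at most |S_{F̄}| edges, hence no more than its subgraph `T`.
  have hTG : T = graphGammaOf L S (fiber L a) :=
    SimpleGraph.edgeSet_inj.1 ((Set.toFinite _).eq_of_subset_of_encard_le
      (SimpleGraph.edgeSet_mono hT) ((encard_edgeSet_le ha hSI).trans hle))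
  refine ⟨hTG ▸ hTree, le_antisymm ?_ (t_le_encard_restrict ha hSI hconn)⟩
  have hcard := (SimpleGraph.isTree_iff_connected_and_card.1 hTree).2
  rw [t, ENat.card_eq_coe_natCard, ← hcard]
  push_cast
  gcongr
  rw [← ENat.card_eq_coe_natCard]
  exact hle

/-- The upper bound uses least cardinality: S_{F̄} for the class of 1 is exchanged for rank L_pure
generators, the result is shrunk to a minimal system, and the finite remainder is cancelled. -/
lemma IsMarkovBasis.encard_restrict_zero {S : Set (MvPolynomial (Fin n) k)}
    (h : IsMarkovBasis L S) :
    (restrict L S (fiber L 0)).encard = (Module.finrank ℤ (pureLattice L) : ℕ∞) := by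
  obtain ⟨hmin, hcard⟩ := h
  have hS : ∀ B ∈ S, B ∈ latticeIdeal k L ∧ IsBinomial B := fun B hB => hmin.mem hB
  have hfin := hmin.finite
  have hpure := latticeIdeal_pureLattice_eq hS hmin.2.1
  apply le_antisymm
  · obtain ⟨P, hPc, hP, hPs⟩ := exists_generators_pureLattice k L
    have hPI : ∀ B ∈ P, B ∈ latticeIdeal k L := fun B hB =>
      Ideal.span_mono (by
        rintro _ ⟨u, v, huv, rfl⟩
        exact ⟨u, v, pureLattice_le huv, rfl⟩) (hP B hB).1
    have hspan := span_exchange (P := P) (a := 0) hmin.2.1 hPI fun B hB =>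
      Ideal.span_mono Set.subset_union_right
        (hPs (restrict_zero_subset (fun B hB => (hS B hB).1) hB))
    have hPfin : P.Finite := Set.finite_of_encard_le_coe hPc
    obtain ⟨T, hT, hTm⟩ := exists_minimal_subset (hfin.sdiff.union hPfin)
      (by
        rintro B (hB | hB)
        · exact (hS B hB.1).2
        · exact (hP B hB).2) hspan
    have h1 : S.encard ≤ (S \ restrict L S (fiber L 0)).encard + P.encard :=
      (hcard T hTm).trans ((Set.encard_le_encard hT).trans (Set.encard_union_le _ _))
    rw [← Set.encard_sdiff_add_encard_of_subset (restrict_subset S (fiber L 0))] at h1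
    refine le_trans ?_ hPc
    exact (ENat.add_le_add_iff_left
      (Set.encard_ne_top_iff.2 (hfin.subset Set.sdiff_subset))).1 h1
  · exact finrank_le_encard _ (fun B hB => (hS B hB.1).2) hpure.le

end LatticeIdeal

/-! ### The characterization of Markov bases. -/

open LatticeIdeal in
theorem theorem4p9 {k : Type*} [Field k] {n : ℕ} (L : AddSubgroup (Fin n → ℤ))
    (S : Set (MvPolynomial (Fin n) k))
    (hS : ∀ B ∈ S, B ∈ LatticeIdeal.latticeIdeal k L ∧ LatticeIdeal.IsBinomial B) :
    LatticeIdeal.IsMarkovBasis L S ↔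
      (∀ F : Set (Fin n →₀ ℕ), LatticeIdeal.IsFiber L F →
        LatticeIdeal.IsSpanningTree (LatticeIdeal.graphGammaOf L S F)
            (LatticeIdeal.graphGamma k L F) ∧
          (F ∉ LatticeIdeal.fiberClass L (LatticeIdeal.fiber L 0) →
            (LatticeIdeal.restrict L S F).encard + 1 = LatticeIdeal.t k L F)) ∧
      (LatticeIdeal.restrict L S (LatticeIdeal.fiber L 0)).encard =
        (Module.finrank ℤ (LatticeIdeal.pureLattice L) : ℕ∞) ∧
      LatticeIdeal.latticeIdeal k (LatticeIdeal.pureLattice L) =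
        Ideal.span (LatticeIdeal.restrict L S (LatticeIdeal.fiber L 0)) := by
  constructor
  · intro h
    refine ⟨?_, h.encard_restrict_zero, latticeIdeal_pureLattice_eq hS h.1.2.1⟩
    rintro _ ⟨a, rfl⟩
    by_cases ha : outside L a = 0
    · exact ⟨⟨le_top, isTree_graphGammaOf_of_outside_eq_zero ha S⟩, fun hn =>
        absurd (fiber_mem_fiberClass_iff.2 (fiberEquiv_zero_iff.2 ha)) hn⟩
    · exact ⟨⟨le_top, (h.1.isTree ha).1⟩, fun _ => (h.1.isTree ha).2⟩
  · rintro ⟨h1, h2, h3⟩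
    have hSI : ∀ B ∈ S, B ∈ latticeIdeal k L := fun B hB => (hS B hB).1
    have hspan : Ideal.span S = latticeIdeal k L :=
      span_eq_of_connected hSI (fun a _ => (h1 _ ⟨a, rfl⟩).1.2.connected) h3.le
    -- Each class of S attains the lower bound valid for every binomial generating set `T`. As `T`
    -- need not be minimal, this serves both for minimality and for least cardinality.
    have hcount : ∀ T : Set (MvPolynomial (Fin n) k), (∀ B ∈ T, IsBinomial B) →
        Ideal.span T = latticeIdeal k L → ∀ a, (restrict L S (fiber L a)).Finite ∧
          (restrict L S (fiber L a)).encard ≤ (restrict L T (fiber L a)).encard := by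
      intro T hTb hTs a
      have hT : ∀ B ∈ T, B ∈ latticeIdeal k L ∧ IsBinomial B := fun B hB =>
        ⟨hTs ▸ Ideal.subset_span hB, hTb B hB⟩
      by_cases ha : outside L a = 0
      · have hE := fiberEquiv_zero_iff.2 ha
        rw [restrict_congr S hE, restrict_congr T hE, h2]
        exact ⟨Set.finite_of_encard_eq_coe h2,
          finrank_le_encard _ (fun B hB => hTb B hB.1) (latticeIdeal_pureLattice_eq hT hTs).le⟩
      · have ht := (h1 _ ⟨a, rfl⟩).2 fun hF =>
          ha (fiberEquiv_zero_iff.1 (fiber_mem_fiberClass_iff.1 hF))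
        refine ⟨Set.encard_ne_top_iff.1 fun htop => t_ne_top (k := k) (L := L) a ?_, ?_⟩
        · rw [← ht, htop, top_add]
        · have := t_le_encard_restrict ha (fun B hB => (hT B hB).1)
            (connected_graphGammaOf ha hT hTs)
          rw [← ht] at this
          exact (ENat.add_le_add_iff_right ENat.one_ne_top).1 this
    refine ⟨⟨fun B hB => (hS B hB).2, hspan, fun T hT hTs => ?_⟩, fun T hT => ?_⟩
    -- A generating proper subset would miss a binomial of some class, yet finiteness and the count
    -- force equality there.
    · obtain ⟨B, hB, hBT⟩ := Set.exists_of_ssubset hT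
      obtain ⟨a, hBa⟩ := exists_mem_restrict hS hB
      obtain ⟨hfin, hle⟩ := hcount T (fun B hB => (hS B (hT.1 hB)).2) hTs a
      have hsub : restrict L T (fiber L a) ⊆ restrict L S (fiber L a) := fun B hB =>
        ⟨hT.1 hB.1, hB.2⟩
      rw [← hfin.eq_of_subset_of_encard_le' hsub hle] at hBa
      exact hBT hBa.1
    · have hclass : ∀ B ∈ S, (S ∩ classOf L ⁻¹' {classOf L B}).Finite ∧
          (S ∩ classOf L ⁻¹' {classOf L B}).encard ≤
            (T ∩ classOf L ⁻¹' {classOf L B}).encard := by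
        intro B hB
        obtain ⟨a, hBa⟩ := exists_mem_restrict hS hB
        rw [restrict_eq_classOf hS] at hBa
        rw [show classOf L B = fiberClass L (fiber L a) from hBa.2, ← restrict_eq_classOf hS,
          ← restrict_eq_classOf fun B hB => hT.mem hB]
        exact hcount T hT.1 hT.2.1 a
      exact encard_le_of_fibers (classOf L) (fun B hB => (hclass B hB).1)
        fun B hB => (hclass B hB).2
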